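/- Let $E$ be a $\sigma$-Dedekind complete (real) Banach lattice, i.e. a Banach lattice in which every nonempty countable subset that is bounded above has a supremum, let $E^*$ be its dual Banach lattice, and let $p\ge 1$ be a real number. Terminology. A sequence $(u_n)_n$ in $E$ or in $E^*$ is disjoint if $|u_m|\wedge|u_n|=0$ whenever $m\neq n$. A sequence $(x_n)_n$ in $E$ is weakly $p$-summable if $\sum_n |x^*(x_n)|^p<\infty$ for every $x^*\in E^*$. A set $A\subseteq E$ is weakly $p$-compact if for every sequence $(x_n)_n$ in $A$ there are a subsequence $(x_{n_k})_k$ and a point $x\in A$ such that $(x_{n_k}-x)_k$ is weakly $p$-summable. A set $A\subseteq E$ is limited if every weak* null sequence in $E^*$ converges to $0$ uniformly on $A$; a bounded set $A\subseteq E$ is almost limited if every disjoint weak* null sequence in $E^*$ converges to $0$ uniformly on $A$. The Banach lattice $E$ has the $p$-weak $DP^*$ property if every weakly $p$-compact subset of $E$ is almost limited, and it has the disjoint Dunford–Pettis$^*$ property of order $p$ (disjoint $DP^*P_p$) if for every disjoint weakly $p$-summable sequence $(x_n)_n$ in $E$ the set $\{x_n : n\in\mathbb N\}$ is limited. Then: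 (a) If $E$ has the $p$-weak $DP^*$ property, then $E$ has the disjoint $DP^*P_p$. (b) If $p\ge 2$, then $E$ has the $p$-weak $DP^*$ property if and only if $E$ has the disjoint $DP^*P_p$. -/

import Mathlib

open Filter Topology

noncomputable section


/-! ### The lattice structure of the dual of a Banach lattice -/

namespace BanachLatticeDual

variable {E : Type*} [NormedAddCommGroup E] [Lattice E] [HasSolidNorm E] [IsOrderedAddMonoid E]
  [NormedSpace ℝ E]

/-- For `x ≥ 0` this is the value at `x` of the positive part of `f`:
`sup {f y : 0 ≤ y ≤ x}`. -/
def posVal (f : StrongDual ℝ E) (x : E) : ℝ := sSup (f '' Set.Icc 0 x)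

theorem le_norm_mul (f : StrongDual ℝ E) {x y : E} (hy : y ∈ Set.Icc 0 x) :
    f y ≤ ‖f‖ * ‖x‖ := by
  have h1 : ‖y‖ ≤ ‖x‖ := HasSolidNorm.solid (by
    rw [abs_of_nonneg hy.1, abs_of_nonneg (hy.1.trans hy.2)]; exact hy.2)
  calc f y ≤ ‖f y‖ := Real.le_norm_self _
    _ ≤ ‖f‖ * ‖y‖ := f.le_opNorm y
    _ ≤ ‖f‖ * ‖x‖ := by gcongr

theorem bddAbove_image (f : StrongDual ℝ E) (x : E) : BddAbove (f '' Set.Icc 0 x) := by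
  refine ⟨‖f‖ * ‖x‖, ?_⟩
  rintro _ ⟨y, hy, rfl⟩
  exact le_norm_mul f hy

theorem apply_le_posVal (f : StrongDual ℝ E) {x y : E} (h0 : 0 ≤ y) (h : y ≤ x) :
    f y ≤ posVal f x :=
  le_csSup (bddAbove_image f x) ⟨y, ⟨h0, h⟩, rfl⟩

theorem posVal_le (f : StrongDual ℝ E) {x : E} (hx : 0 ≤ x) {c : ℝ}
    (h : ∀ y, 0 ≤ y → y ≤ x → f y ≤ c) : posVal f x ≤ c := by
  refine csSup_le ⟨f 0, 0, ⟨le_rfl, hx⟩, rfl⟩ ?_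
  rintro _ ⟨y, hy, rfl⟩
  exact h y hy.1 hy.2

theorem posVal_nonneg (f : StrongDual ℝ E) {x : E} (hx : 0 ≤ x) : 0 ≤ posVal f x := by
  simpa using apply_le_posVal f le_rfl hx

theorem posVal_add (f : StrongDual ℝ E) {x y : E} (hx : 0 ≤ x) (hy : 0 ≤ y) :
    posVal f (x + y) = posVal f x + posVal f y := by
  apply le_antisymm
  · refine posVal_le f (add_nonneg hx hy) fun z hz hzxy => ?_
    have h1 : f (z ⊓ x) ≤ posVal f x := apply_le_posVal f (le_inf hz hx) inf_le_right
    have h2 : f (z - z ⊓ x) ≤ posVal f y := by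
      refine apply_le_posVal f (sub_nonneg.2 inf_le_left) ?_
      rw [sub_le_iff_le_add, add_inf]
      exact le_inf (le_add_of_nonneg_left hy) (by rwa [add_comm y x])
    have h3 : f z = f (z ⊓ x) + f (z - z ⊓ x) := by rw [← map_add]; congr 1; abel
    linarith
  · have h : ∀ a, 0 ≤ a → a ≤ x → f a ≤ posVal f (x + y) - posVal f y := by
      intro a ha hax
      have : posVal f y ≤ posVal f (x + y) - f a := by
        refine posVal_le f hy fun b hb hby => ?_
        have := apply_le_posVal f (add_nonneg ha hb) (add_le_add hax hby)
        rw [map_add] at this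
        linarith
      linarith
    linarith [posVal_le f hx h]

/-- Extension of `posVal f` from the positive cone to `E`. -/
def posFun (f : StrongDual ℝ E) (x : E) : ℝ := posVal f x⁺ - posVal f x⁻

theorem posFun_sub (f : StrongDual ℝ E) {a b : E} (ha : 0 ≤ a) (hb : 0 ≤ b) :
    posFun f (a - b) = posVal f a - posVal f b := by
  have h1 : a + (a - b)⁻ = b + (a - b)⁺ := by
    rw [← sub_eq_zero]
    have := posPart_sub_negPart (a - b)
    calc a + (a - b)⁻ - (b + (a - b)⁺) = (a - b) - ((a - b)⁺ - (a - b)⁻) := by abel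
      _ = 0 := by rw [this, sub_self]
  have h2 := congrArg (posVal f) h1
  rw [posVal_add f ha (negPart_nonneg _), posVal_add f hb (posPart_nonneg _)] at h2
  unfold posFun
  linarith

theorem posFun_of_nonneg (f : StrongDual ℝ E) {x : E} (hx : 0 ≤ x) :
    posFun f x = posVal f x := by
  unfold posFun
  have h0 : posVal f (0 : E) = 0 := by
    have := posVal_add f (le_refl (0 : E)) le_rfl
    rw [add_zero] at this
    linarith
  rw [posPart_of_nonneg hx, negPart_of_nonneg hx, h0, sub_zero]

theorem posFun_add (f : StrongDual ℝ E) (x y : E) :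
    posFun f (x + y) = posFun f x + posFun f y := by
  have h : x + y = (x⁺ + y⁺) - (x⁻ + y⁻) := by
    conv_lhs => rw [← posPart_sub_negPart x, ← posPart_sub_negPart y]
    abel
  rw [h, posFun_sub f (add_nonneg (posPart_nonneg _) (posPart_nonneg _))
    (add_nonneg (negPart_nonneg _) (negPart_nonneg _)),
    posVal_add f (posPart_nonneg _) (posPart_nonneg _),
    posVal_add f (negPart_nonneg _) (negPart_nonneg _)]
  unfold posFun
  ring

theorem norm_posFun_le (f : StrongDual ℝ E) (x : E) : ‖posFun f x‖ ≤ ‖f‖ * ‖x‖ := by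
  have key : ∀ z : E, 0 ≤ z → z ≤ |x| → posVal f z ≤ ‖f‖ * ‖x‖ := by
    intro z hz hzx
    refine posVal_le f hz fun y hy hyz => ?_
    have := le_norm_mul f ⟨hy, hyz.trans hzx⟩
    rwa [norm_abs_eq_norm] at this
  have h1 := key x⁺ (posPart_nonneg x) (sup_le (le_abs_self x) (abs_nonneg x))
  have h2 := key x⁻ (negPart_nonneg x) (sup_le (neg_le_abs x) (abs_nonneg x))
  have h3 := posVal_nonneg f (posPart_nonneg x)
  have h4 := posVal_nonneg f (negPart_nonneg x)
  rw [Real.norm_eq_abs, abs_le]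
  unfold posFun
  constructor <;> linarith

/-- The positive part `f⁺` of a bounded functional `f`, by the Riesz–Kantorovich formula. -/
def pos (f : StrongDual ℝ E) : StrongDual ℝ E :=
  let P : E →+ ℝ :=
    { toFun := posFun f
      map_zero' := by simpa using posFun_add f 0 0
      map_add' := posFun_add f }
  P.toRealLinearMap (AddMonoidHomClass.continuous_of_bound P ‖f‖ (norm_posFun_le f))

theorem pos_apply (f : StrongDual ℝ E) {x : E} (hx : 0 ≤ x) :
    pos f x = sSup (f '' Set.Icc 0 x) :=
  posFun_of_nonneg f hx

/-- The canonical order of the dual: `f ≤ g` iff `f x ≤ g x` for all `x ≥ 0`. -/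
instance instPartialOrder : PartialOrder (StrongDual ℝ E) where
  le f g := ∀ x : E, 0 ≤ x → f x ≤ g x
  le_refl _ _ _ := le_rfl
  le_trans _ _ _ h1 h2 x hx := (h1 x hx).trans (h2 x hx)
  le_antisymm f g h1 h2 := by
    ext x
    rw [← posPart_sub_negPart x, map_sub, map_sub,
      le_antisymm (h1 _ (posPart_nonneg x)) (h2 _ (posPart_nonneg x)),
      le_antisymm (h1 _ (negPart_nonneg x)) (h2 _ (negPart_nonneg x))]

theorem le_def {f g : StrongDual ℝ E} : f ≤ g ↔ ∀ x : E, 0 ≤ x → f x ≤ g x := Iff.rfl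

theorem le_pos (f : StrongDual ℝ E) : f ≤ pos f := fun x hx => by
  rw [pos_apply f hx]; exact apply_le_posVal f hx le_rfl

theorem zero_le_pos (f : StrongDual ℝ E) : 0 ≤ pos f := fun x hx => by
  rw [pos_apply f hx]; exact posVal_nonneg f hx

theorem pos_le {f g : StrongDual ℝ E} (h : f ≤ g) (h0 : 0 ≤ g) : pos f ≤ g := fun x hx => by
  rw [pos_apply f hx]
  refine posVal_le f hx fun y hy hyx => (h y hy).trans ?_
  have := h0 (x - y) (sub_nonneg.2 hyx)
  rw [map_sub] at this
  simpa using this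

/-- The dual of a Banach lattice is a vector lattice for its canonical order:
`f ⊔ g = f + (g - f)⁺` and `f ⊓ g = f - (f - g)⁺`. -/
instance instLattice : Lattice (StrongDual ℝ E) where
  __ := (instPartialOrder : PartialOrder (StrongDual ℝ E))
  sup f g := f + pos (g - f)
  inf f g := f - pos (f - g)
  le_sup_left f g x hx := by
    have := zero_le_pos (g - f) x hx
    simpa using this
  le_sup_right f g x hx := by
    have := le_pos (g - f) x hx
    simp only [sub_apply, add_apply] at this ⊢
    linarith
  sup_le f g h hf hg x hx := by
    have := pos_le (f := g - f) (g := h - f)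
      (fun y hy => by simpa using hg y hy) (fun y hy => by simpa using hf y hy) x hx
    simp only [sub_apply, add_apply] at this ⊢
    linarith
  inf_le_left f g x hx := by
    have := zero_le_pos (f - g) x hx
    simpa using this
  inf_le_right f g x hx := by
    have := le_pos (f - g) x hx
    simp only [sub_apply] at this ⊢
    linarith
  le_inf h f g hf hg x hx := by
    have := pos_le (f := f - g) (g := f - h)
      (fun y hy => sub_le_sub_left (hg y hy) (f y)) (fun y hy => sub_nonneg.2 (hf y hy)) x hx
    simp only [sub_apply] at this ⊢
    linarith

end BanachLatticeDual

/-! ### Notions for sequences and sets -/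

/-- A sequence in a vector lattice is disjoint if `|u m| ⊓ |u n| = 0` for `m ≠ n`. -/
def IsDisjointSeq {V : Type*} [Lattice V] [AddCommGroup V] (u : ℕ → V) : Prop :=
  ∀ m n : ℕ, m ≠ n → |u m| ⊓ |u n| = 0

/-- Every nonempty countable set that is bounded above has a supremum. -/
def IsSigmaDedekindComplete (E : Type*) [Lattice E] : Prop :=
  ∀ s : Set E, s.Nonempty → s.Countable → BddAbove s → ∃ a : E, IsLUB s a

section Banach

variable {E : Type*} [NormedAddCommGroup E] [NormedSpace ℝ E]

/-- `(x n)` is weakly `p`-summable if `∑ |f (x n)| ^ p < ∞` for every `f` in the dual. -/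
def IsWeaklyPSummable (p : ℝ) (x : ℕ → E) : Prop :=
  ∀ f : StrongDual ℝ E, Summable fun n => |f (x n)| ^ p

/-- Every sequence in `A` has a subsequence that is weakly `p`-convergent to a point `a` of `A`,
i.e. the differences with `a` form a weakly `p`-summable sequence. -/
def IsWeaklyPCompact (p : ℝ) (A : Set E) : Prop :=
  ∀ x : ℕ → E, (∀ n, x n ∈ A) →
    ∃ a ∈ A, ∃ φ : ℕ → ℕ, StrictMono φ ∧ IsWeaklyPSummable p fun n => x (φ n) - a

/-- Convergence to zero of a sequence of functionals in the weak* topology. -/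
def IsWeakStarNull (f : ℕ → StrongDual ℝ E) : Prop :=
  Tendsto (fun n => StrongDual.toWeakDual (f n)) atTop (𝓝 0)

/-- Every weak* null sequence of functionals converges to zero uniformly on `A`. -/
def IsLimitedSet (A : Set E) : Prop :=
  ∀ f : ℕ → StrongDual ℝ E, IsWeakStarNull f →
    TendstoUniformlyOn (fun n x => f n x) (fun _ => (0 : ℝ)) atTop A

end Banach

section BanachLattice

variable (E : Type*) [NormedAddCommGroup E] [Lattice E] [HasSolidNorm E] [IsOrderedAddMonoid E]
  [NormedSpace ℝ E]

variable {E} in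
/-- `A` is bounded and every disjoint weak* null sequence of functionals converges to zero
uniformly on `A`. -/
def IsAlmostLimitedSet (A : Set E) : Prop :=
  Bornology.IsBounded A ∧ ∀ f : ℕ → StrongDual ℝ E, IsDisjointSeq f → IsWeakStarNull f →
    TendstoUniformlyOn (fun n x => f n x) (fun _ => (0 : ℝ)) atTop A

/-- The `p`-weak DP* property: weakly `p`-compact sets are almost limited. -/
def HasPWeakDPStar (p : ℝ) : Prop :=
  ∀ A : Set E, IsWeaklyPCompact p A → IsAlmostLimitedSet A

/-- The disjoint Dunford–Pettis* property of order `p`: the set of terms of every disjoint weakly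
`p`-summable sequence is limited. -/
def HasDisjointDPStar (p : ℝ) : Prop :=
  ∀ x : ℕ → E, IsDisjointSeq x → IsWeaklyPSummable p x → IsLimitedSet (Set.range x)

end BanachLattice

end

/-!
The main tool is disjointification: among vectors `0 ≤ v k ≤ a k • u` the vectors
`(v k - a k • ∑ i < k, v i - u)⁺` are pairwise disjoint, and `|f k|` is almost as large on them as
on `v k` as soon as the `|f k| (v i)`, `i < k`, and `|f k| u` are small enough.

Suppose first that weakly `p`-compact sets are almost limited. A weak* null sequence `f`, composed
with the band projections onto the terms of a disjoint sequence `x`, becomes a disjoint sequence `g`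
with `g n (x n) = f n (x n)`. It is still weak* null, by Rosenthal's lemma applied to the set
functions `A ↦ |f n| (sup_{k ∈ A} z k)` of disjoint order bounded sequences `z ≥ 0`. Since
`{0} ∪ {x n}` is weakly `p`-compact when `x` is weakly `p`-summable, `g n (x n) → 0`.

Conversely, let `f` be disjoint and weak* null and `x` weakly `p`-summable. Disjointification shows
that `|f n| u → 0` for every `u ≥ 0`; if now `|f n (x n)| ≥ ε` for all `n`, applying it to a
subsequence of `|x n|` gives a disjoint `z` with `|z k| ≤ |x (φ k)|` and `f (φ k) (z k) > ε / 4`.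
Such a `z` is again weakly `p`-summable: averaging over signs yields an upper bound of the
`|c i • x i|` whose norm is at most `sup ‖∑ ± c i • x i‖`, by disjointness it also dominates
`∑ |c i • z i|`, and `ℓ^p`-`ℓ^q` duality concludes. So the terms of `z` form a limited set, which
contradicts `f (φ k) (z k) > ε / 4`.
-/

theorem exists_strictMono_const_or_strictMono_comp (m : ℕ → ℕ) :
    ∃ φ : ℕ → ℕ, StrictMono φ ∧ ((∃ j, ∀ k, m (φ k) = j) ∨ StrictMono (m ∘ φ)) := by
  by_cases h : ∃ j, ∃ᶠ k in atTop, m k = j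
  · obtain ⟨j, hj⟩ := h
    obtain ⟨φ, hφ, hmφ⟩ := extraction_of_frequently_atTop hj
    exact ⟨φ, hφ, .inl ⟨j, hmφ⟩⟩
  · push Not at h
    have hm : Tendsto m atTop atTop := by
      rw [← Nat.cofinite_eq_atTop] at h ⊢
      exact le_cofinite_iff_eventually_ne.2 h
    obtain ⟨φ, hφ, hmφ⟩ := strictMono_subseq_of_tendsto_atTop hm
    exact ⟨φ, hφ, .inr hmφ⟩

theorem tendsto_zero_of_forall_strictMono_exists_abs_lt {u : ℕ → ℝ}
    (h : ∀ ε > 0, ∀ φ : ℕ → ℕ, StrictMono φ → ∃ k, |u (φ k)| < ε) : Tendsto u atTop (𝓝 0) := by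
  rw [Metric.tendsto_nhds]
  by_contra! hcon
  obtain ⟨ε, hε, hfreq⟩ := hcon
  obtain ⟨φ, hφ, hφε⟩ := extraction_of_frequently_atTop hfreq
  obtain ⟨k, hk⟩ := h ε hε φ hφ
  exact (hφε k).not_gt (by simpa only [Real.dist_eq, sub_zero] using hk)

theorem tendstoUniformlyOn_zero_iff_forall_seq {α : Type*} {F : ℕ → α → ℝ} {A : Set α} :
    TendstoUniformlyOn F (fun _ => 0) atTop A ↔
      ∀ a : ℕ → α, (∀ n, a n ∈ A) → Tendsto (fun n => F n (a n)) atTop (𝓝 0) := by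
  simp only [Metric.tendstoUniformlyOn_iff, Metric.tendsto_nhds]
  refine ⟨fun h a ha ε hε => (h ε hε).mono fun n hn => by simpa only [dist_comm] using hn _ (ha n),
    fun h ε hε => ?_⟩
  by_contra hcon
  have hA : ∃ x, x ∈ A := by
    by_contra! hA
    exact hcon (.of_forall fun n x hx => absurd hx (hA x))
  obtain ⟨x₀, hx₀⟩ := hA
  have hchoice : ∀ n, ∃ x ∈ A, (∃ y ∈ A, ε ≤ dist 0 (F n y)) → ε ≤ dist 0 (F n x) := fun n => by
    by_cases hn : ∃ y ∈ A, ε ≤ dist 0 (F n y)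
    · obtain ⟨y, hy, hyε⟩ := hn
      exact ⟨y, hy, fun _ => hyε⟩
    · exact ⟨x₀, hx₀, fun h => absurd h hn⟩
  choose a ha haε using hchoice
  refine hcon ((h a ha ε hε).mono fun n hn => ?_)
  by_contra! hlt
  exact (haε n hlt).not_gt (by rwa [dist_comm])

theorem exists_strictMono_forall_lt_lt {a : ℕ → ℕ → ℝ}
    (ha : ∀ m, Tendsto (fun n => a n m) atTop (𝓝 0)) {η : ℕ → ℝ} (hη : ∀ k, 0 < η k) :
    ∃ φ : ℕ → ℕ, StrictMono φ ∧ ∀ i k, i < k → a (φ k) (φ i) < η k := by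
  have hnext : ∀ m, ∃ n > m, ∀ j ≤ m, ∀ k ≤ m + 1, a n j < η k := fun m => by
    have hsmall : ∀ᶠ n in atTop, ∀ j ≤ m, ∀ k ≤ m + 1, a n j < η k := by
      simp only [← Set.mem_Iic, (Set.finite_Iic _).eventually_all]
      exact fun j _ k _ => (ha j).eventually_lt_const (hη k)
    exact ((eventually_gt_atTop m).and hsmall).exists
  choose g hg hgη using hnext
  have hsucc : ∀ k, g^[k + 1] 0 = g (g^[k] 0) := fun k => Function.iterate_succ_apply' g k 0
  have hmono : StrictMono fun k => g^[k] 0 :=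
    strictMono_nat_of_lt_succ fun k => (hg _).trans_eq (hsucc k).symm
  refine ⟨_, hmono, fun i k hik => ?_⟩
  obtain ⟨k, rfl⟩ := Nat.exists_eq_succ_of_ne_zero hik.ne_bot
  simp only [Nat.succ_eq_add_one, hsucc]
  exact hgη _ _ (hmono.monotone (Nat.lt_succ_iff.1 hik)) _ (Nat.succ_le_succ (hmono.id_le k))

-- If `∑ b i ^ p ≤ 1`, then the `b i ^ (p - 1)` lie in the unit ball of `ℓ^q` with `1/p + 1/q = 1`;
-- writing its elements this way treats `p = 1` together with `p > 1`.
theorem rpow_sub_one_mul_le_add {b c p : ℝ} (hb : 0 ≤ b) (hc : 0 ≤ c) (hp : 1 ≤ p) :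
    b ^ (p - 1) * c ≤ b ^ p + c ^ p := by
  have hself : ∀ {t : ℝ}, 0 ≤ t → t ^ (p - 1) * t = t ^ p := fun ht => by
    rw [← Real.rpow_add_one' ht (by linarith), sub_add_cancel]
  obtain hbc | hcb := le_total b c
  · calc b ^ (p - 1) * c ≤ c ^ (p - 1) * c := by gcongr
      _ = c ^ p := hself hc
      _ ≤ b ^ p + c ^ p := le_add_of_nonneg_left (Real.rpow_nonneg hb p)
  · calc b ^ (p - 1) * c ≤ b ^ (p - 1) * b := by gcongr
      _ = b ^ p := hself hb
      _ ≤ b ^ p + c ^ p := le_add_of_nonneg_right (Real.rpow_nonneg hc p)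

theorem summable_rpow_of_forall_sum_rpow_sub_one_mul_le {ι : Type*} {c : ι → ℝ} {p K : ℝ}
    (hp : 0 < p) (hc : ∀ i, 0 ≤ c i)
    (h : ∀ (s : Finset ι) (b : ι → ℝ), (∀ i, 0 ≤ b i) → ∑ i ∈ s, b i ^ p ≤ 1 →
      ∑ i ∈ s, b i ^ (p - 1) * c i ≤ K) : Summable fun i => c i ^ p := by
  have hcp : ∀ i, 0 ≤ c i ^ p := fun i => Real.rpow_nonneg (hc i) p
  refine summable_of_sum_le (c := K ^ p) hcp fun s => ?_
  set T := ∑ i ∈ s, c i ^ p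
  have hT : 0 ≤ T := Finset.sum_nonneg fun i _ => hcp i
  set t := T ^ p⁻¹
  have ht : 0 ≤ t := Real.rpow_nonneg hT _
  have htp : t ^ p = T := Real.rpow_inv_rpow hT hp.ne'
  suffices htK : t ≤ K by simpa only [htp] using Real.rpow_le_rpow ht htK hp.le
  obtain ht0 | ht0 := ht.eq_or_lt
  · rw [← ht0]
    simpa only [Finset.sum_empty] using h ∅ 0 (fun _ => le_rfl) (by simp)
  let b : ι → ℝ := fun i => c i / t
  have hb : ∀ i, 0 ≤ b i := fun i => div_nonneg (hc i) ht
  have hbp : ∑ i ∈ s, b i ^ p = 1 := by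
    simp only [b, Real.div_rpow (hc _) ht, htp, ← Finset.sum_div]
    exact div_self (htp.symm.trans_ne (Real.rpow_pos_of_pos ht0 p).ne')
  calc t = ∑ i ∈ s, b i ^ p * t := by rw [← Finset.sum_mul, hbp, one_mul]
    _ = ∑ i ∈ s, b i ^ (p - 1) * c i := Finset.sum_congr rfl fun i _ => by
        rw [← sub_add_cancel p 1, Real.rpow_add_one' (hb i) (by linarith), add_sub_cancel_right,
          mul_assoc, div_mul_cancel₀ _ ht0.ne']
    _ ≤ K := h s b hb hbp.le

theorem exists_pairwise_disjoint_infinite_subsets {α : Type*} {S : Set α} (hS : S.Infinite) :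
    ∃ N : ℕ → Set α, (∀ p, N p ⊆ S) ∧ (∀ p, (N p).Infinite) ∧
      Pairwise (Function.onFun Disjoint N) := by
  let e := hS.natEmbedding
  have he : ∀ {p q k l : ℕ}, (e (Nat.pair p k) : α) = e (Nat.pair q l) → p = q ∧ k = l :=
    fun h => Nat.pair_eq_pair.1 (e.injective (Subtype.ext h))
  refine ⟨fun p => Set.range fun k => (e (Nat.pair p k) : α), fun p => ?_,
    fun p => Set.infinite_range_of_injective fun k l hkl => (he hkl).2, fun p q hpq => ?_⟩
  · rintro _ ⟨k, rfl⟩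
    exact (e _).2
  · refine Set.disjoint_left.2 ?_
    rintro _ ⟨k, rfl⟩ ⟨l, hl⟩
    exact hpq (he hl).1.symm

section Rosenthal

variable {μ : ℕ → Set ℕ → ℝ} {C ε : ℝ}

theorem exists_infinite_forall_diff_singleton_lt_or_forall_add_le (hmono : ∀ n, Monotone (μ n))
    (hadd : ∀ n A B, Disjoint A B → μ n A + μ n B ≤ μ n (A ∪ B)) (ε : ℝ) {S : Set ℕ}
    (hS : S.Infinite) :
    (∃ M : Set ℕ, M.Infinite ∧ ∀ n ∈ M, μ n (M \ {n}) < ε) ∨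
      ∃ M ⊆ S, M.Infinite ∧ ∀ n ∈ M, μ n M + ε ≤ μ n S := by
  obtain ⟨N, hNS, hN, hdisj⟩ := exists_pairwise_disjoint_infinite_subsets hS
  by_cases hp : ∃ p, ∀ n ∈ N p, μ n (N p \ {n}) < ε
  · obtain ⟨p, hp⟩ := hp
    exact .inl ⟨N p, hN p, hp⟩
  push Not at hp
  choose m hm hmε using hp
  have hmN : ∀ {p q}, m p ∈ N q → p = q := fun {p q} h => by
    by_contra hpq
    exact Set.disjoint_left.1 (hdisj hpq) (hm p) h
  have hinj : Function.Injective m := fun p q hpq => hmN (hpq ▸ hm q)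
  have hmS : Set.range m ⊆ S := Set.range_subset_iff.2 fun p => hNS p (hm p)
  refine .inr ⟨Set.range m, hmS, Set.infinite_range_of_injective hinj, ?_⟩
  rintro _ ⟨p, rfl⟩
  have hdisj' : Disjoint (Set.range m) (N p \ {m p}) := by
    rw [Set.disjoint_left]
    rintro _ ⟨q, rfl⟩ ⟨hq, hqp⟩
    exact hqp (congrArg m (hmN hq))
  calc μ (m p) (Set.range m) + ε
      ≤ μ (m p) (Set.range m) + μ (m p) (N p \ {m p}) := by gcongr; exact hmε p
    _ ≤ μ (m p) (Set.range m ∪ N p \ {m p}) := hadd _ _ _ hdisj'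
    _ ≤ μ (m p) S := hmono _ (Set.union_subset hmS (Set.sdiff_subset.trans (hNS p)))

/-- Rosenthal's lemma. -/
theorem exists_infinite_forall_diff_singleton_lt (hmono : ∀ n, Monotone (μ n))
    (hadd : ∀ n A B, Disjoint A B → μ n A + μ n B ≤ μ n (A ∪ B)) (hC : ∀ n, μ n Set.univ ≤ C)
    (hε : 0 < ε) : ∃ M : Set ℕ, M.Infinite ∧ ∀ n ∈ M, μ n (M \ {n}) < ε := by
  have hind : ∀ k : ℕ, ∀ S : Set ℕ, S.Infinite → (∀ n ∈ S, μ n S ≤ k * ε) →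
      ∃ M : Set ℕ, M.Infinite ∧ ∀ n ∈ M, μ n (M \ {n}) < ε := by
    intro k
    induction k with
    | zero =>
      refine fun S hS h => ⟨S, hS, fun n hn => ?_⟩
      calc μ n (S \ {n}) ≤ μ n S := hmono n Set.sdiff_subset
        _ ≤ (0 : ℕ) * ε := h n hn
        _ < ε := by simpa only [Nat.cast_zero, zero_mul] using hε
    | succ k ih =>
      intro S hS h
      obtain hM | ⟨M, hMS, hM, hMle⟩ :=
        exists_infinite_forall_diff_singleton_lt_or_forall_add_le hmono hadd ε hS
      · exact hM
      · refine ih M hM fun n hn => ?_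
        have := (hMle n hn).trans (h n (hMS hn))
        push_cast at this
        linarith
  obtain ⟨k, hk⟩ := exists_nat_ge (C / ε)
  exact hind k Set.univ Set.infinite_univ fun n _ => (hC n).trans ((div_le_iff₀ hε).1 hk)

end Rosenthal

section VectorLattice

variable {V : Type*} [Lattice V] [AddCommGroup V]

theorem isDisjointSeq_of_lt {u : ℕ → V} (h : ∀ m n, m < n → |u m| ⊓ |u n| = 0) :
    IsDisjointSeq u := fun m n hmn => by
  rcases hmn.lt_or_gt with hlt | hgt
  · exact h m n hlt
  · rw [inf_comm]
    exact h n m hgt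

theorem IsDisjointSeq.comp_injective {u : ℕ → V} (hu : IsDisjointSeq u) {φ : ℕ → ℕ}
    (hφ : Function.Injective φ) : IsDisjointSeq (u ∘ φ) := fun _ _ hmn =>
  hu _ _ (hφ.ne hmn)

theorem inf_eq_zero_of_le {a b c d : V} (ha : 0 ≤ a) (hb : 0 ≤ b) (hac : a ≤ c) (hbd : b ≤ d)
    (h : c ⊓ d = 0) : a ⊓ b = 0 :=
  le_antisymm ((inf_le_inf hac hbd).trans h.le) (le_inf ha hb)

variable [IsOrderedAddMonoid V]

theorem IsDisjointSeq.of_abs_le {u v : ℕ → V} (hu : IsDisjointSeq u) (h : ∀ n, |v n| ≤ |u n|) :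
    IsDisjointSeq v := fun m n hmn =>
  inf_eq_zero_of_le (abs_nonneg _) (abs_nonneg _) (h m) (h n) (hu m n hmn)

theorem inf_add_eq_zero {a b c : V} (hab : a ⊓ b = 0) (hac : a ⊓ c = 0) : a ⊓ (b + c) = 0 := by
  have ha : 0 ≤ a := hab.symm.trans_le inf_le_left
  have hb : 0 ≤ b := hab.symm.trans_le inf_le_right
  have hc : 0 ≤ c := hac.symm.trans_le inf_le_right
  have hle : a ⊓ (b + c) - c ≤ a ⊓ b :=
    le_inf ((sub_le_self _ hc).trans inf_le_left) (sub_le_iff_le_add.2 inf_le_right)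
  rw [hab, sub_nonpos] at hle
  exact le_antisymm ((le_inf inf_le_left hle).trans hac.le) (le_inf ha (add_nonneg hb hc))

theorem inf_sum_eq_zero {ι : Type*} {s : Finset ι} {a : V} {v : ι → V} (ha : 0 ≤ a)
    (h : ∀ i ∈ s, a ⊓ v i = 0) : a ⊓ ∑ i ∈ s, v i = 0 :=
  Finset.sum_induction v (fun b => a ⊓ b = 0) (fun _ _ => inf_add_eq_zero) (inf_of_le_right ha) h

theorem add_le_of_inf_eq_zero {a b c : V} (h : a ⊓ b = 0) (ha : a ≤ c) (hb : b ≤ c) :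
    a + b ≤ c := by
  rw [← inf_add_sup a b, h, zero_add]
  exact sup_le ha hb

theorem sum_le_of_pairwise_inf_eq_zero {ι : Type*} {s : Finset ι} {v : ι → V} {u : V}
    (hu : 0 ≤ u) (hv : ∀ i ∈ s, 0 ≤ v i) (h : (s : Set ι).Pairwise fun i j => v i ⊓ v j = 0)
    (hvu : ∀ i ∈ s, v i ≤ u) : ∑ i ∈ s, v i ≤ u := by
  classical
  induction s using Finset.induction_on with
  | empty => simpa using hu
  | insert i s hi ih =>
    simp only [Finset.mem_insert, forall_eq_or_imp] at hv hvu
    rw [Finset.coe_insert, Set.pairwise_insert_of_notMem hi] at h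
    rw [Finset.sum_insert hi]
    exact add_le_of_inf_eq_zero (inf_sum_eq_zero hv.1 fun j hj => (h.2 j hj).1) hvu.1
      (ih hv.2 h.1 hvu.2)

theorem add_inf_le_inf_add_inf {a b c : V} (ha : 0 ≤ a) (hb : 0 ≤ b) (hc : 0 ≤ c) :
    (a + b) ⊓ c ≤ a ⊓ c + b ⊓ c := by
  rw [add_inf, inf_add, inf_add]
  exact le_inf (le_inf inf_le_left (inf_le_right.trans (le_add_of_nonneg_right hb)))
    (le_inf (inf_le_right.trans (le_add_of_nonneg_left ha))
      (inf_le_right.trans (le_add_of_nonneg_left hc)))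

theorem inf_eq_zero_of_isLUB {S : Set V} {a b : V} (hS : S.Nonempty) (hb : IsLUB S b)
    (h : ∀ s ∈ S, a ⊓ s = 0) : a ⊓ b = 0 := by
  obtain ⟨s₀, hs₀⟩ := hS
  have hnonneg : 0 ≤ a ⊓ b := (h s₀ hs₀).symm.trans_le (inf_le_inf_left a (hb.1 hs₀))
  have hub : b ≤ b - a ⊓ b := (isLUB_le_iff hb).2 fun s hs => by
    have hs0 : 0 ≤ s := (h s hs).symm.trans_le inf_le_right
    have hdisj : a ⊓ b ⊓ s = 0 := inf_eq_zero_of_le hnonneg hs0 inf_le_left le_rfl (h s hs)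
    exact le_sub_iff_add_le'.2 (add_le_of_inf_eq_zero hdisj inf_le_right (hb.1 hs))
  exact le_antisymm ((le_sub_self_iff b).1 hub) hnonneg

theorem exists_additive_apply_singleton_eq (hE : IsSigmaDedekindComplete V) {x : V} {z : ℕ → V}
    (hz : IsDisjointSeq z) (hz0 : ∀ n, 0 ≤ z n) (hzx : ∀ n, z n ≤ x) :
    ∃ Z : Set ℕ → V, (∀ n, Z {n} = z n) ∧ (∀ A, 0 ≤ Z A) ∧ (∀ A, Z A ≤ x) ∧
      ∀ A B, Disjoint A B → Z (A ∪ B) = Z A + Z B := by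
  have hzdisj : ∀ {m n}, m ≠ n → z m ⊓ z n = 0 := fun {m n} hmn => by
    simpa only [abs_of_nonneg (hz0 _)] using hz m n hmn
  have hub : ∀ {A : Set ℕ} {c : V}, 0 ≤ c → (∀ n ∈ A, z n ≤ c) →
      c ∈ upperBounds (insert 0 (z '' A)) := fun {A c} hc h => by
    rintro _ (rfl | ⟨n, hn, rfl⟩)
    exacts [hc, h n hn]
  have hlub : ∀ A : Set ℕ, ∃ a, IsLUB (insert 0 (z '' A)) a := fun A =>
    hE _ (Set.insert_nonempty _ _) ((A.to_countable.image z).insert 0)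
      ⟨x, hub ((hz0 0).trans (hzx 0)) fun n _ => hzx n⟩
  choose Z hZ using hlub
  have hZ0 : ∀ A, 0 ≤ Z A := fun A => (hZ A).1 (Set.mem_insert _ _)
  have hle : ∀ {A : Set ℕ} {n}, n ∈ A → z n ≤ Z A := fun {A n} hn =>
    (hZ A).1 (Set.mem_insert_of_mem _ ⟨n, hn, rfl⟩)
  have hZle : ∀ {A : Set ℕ} {c : V}, 0 ≤ c → (∀ n ∈ A, z n ≤ c) → Z A ≤ c := fun {A c} hc h =>
    (hZ A).2 (hub hc h)
  have hZmono : Monotone Z := fun A B h => hZle (hZ0 B) fun n hn => hle (h hn)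
  have hZdisj : ∀ A B, Disjoint A B → Z A ⊓ Z B = 0 := fun A B hAB => by
    refine inf_eq_zero_of_isLUB (Set.insert_nonempty _ _) (hZ B) ?_
    rintro _ (rfl | ⟨n, hn, rfl⟩)
    · exact inf_of_le_right (hZ0 A)
    rw [inf_comm]
    refine inf_eq_zero_of_isLUB (Set.insert_nonempty _ _) (hZ A) ?_
    rintro _ (rfl | ⟨m, hm, rfl⟩)
    · exact inf_of_le_right (hz0 n)
    · exact hzdisj (hAB.ne_of_mem hm hn).symm
  refine ⟨Z, fun n => ?_, hZ0, fun A => hZle ((hz0 0).trans (hzx 0)) fun n _ => hzx n,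
    fun A B hAB => le_antisymm ?_ ?_⟩
  · exact le_antisymm (hZle (hz0 n) (by simp)) (hle rfl)
  · refine hZle (add_nonneg (hZ0 A) (hZ0 B)) ?_
    rintro n (hn | hn)
    exacts [(hle hn).trans (le_add_of_nonneg_right (hZ0 B)),
      (hle hn).trans (le_add_of_nonneg_left (hZ0 A))]
  · exact add_le_of_inf_eq_zero (hZdisj A B hAB) (hZmono Set.subset_union_left)
      (hZmono Set.subset_union_right)

variable [Module ℝ V] [IsOrderedModule ℝ V]

theorem inf_eq_zero_of_le_smul {a b c d : V} {r s : ℝ} (ha : 0 ≤ a) (hb : 0 ≤ b)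
    (hac : a ≤ r • c) (hbd : b ≤ s • d) (h : c ⊓ d = 0) : a ⊓ b = 0 := by
  have hc : 0 ≤ c := h.symm.trans_le inf_le_left
  have hd : 0 ≤ d := h.symm.trans_le inf_le_right
  let K : ℝ := max 1 (max r s)
  have hK : 0 < K := zero_lt_one.trans_le (le_max_left _ _)
  have hrK : r ≤ K := (le_max_left _ _).trans (le_max_right _ _)
  have hsK : s ≤ K := (le_max_right _ _).trans (le_max_right _ _)
  have hle : K⁻¹ • (a ⊓ b) ≤ c ⊓ d := by
    refine le_inf ?_ ?_ <;> rw [inv_smul_le_iff_of_pos hK]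
    · exact inf_le_left.trans (hac.trans (smul_le_smul_of_nonneg_right hrK hc))
    · exact inf_le_right.trans (hbd.trans (smul_le_smul_of_nonneg_right hsK hd))
  rw [h, inv_smul_le_iff_of_pos hK, smul_zero] at hle
  exact le_antisymm hle (le_inf ha hb)

theorem abs_smul_of_nonneg {c : ℝ} (hc : 0 ≤ c) (x : V) : |c • x| = c • |x| := by
  obtain rfl | hc := hc.eq_or_lt
  · simp only [zero_smul, abs_zero]
  · change c • x ⊔ -(c • x) = c • (x ⊔ -x)
    rw [← smul_neg]
    exact ((OrderIso.smulRight hc : V ≃o V).map_sup x (-x)).symm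

theorem abs_le_half_smul_abs_add_add_abs_sub (x y : V) :
    |x| ≤ (2⁻¹ : ℝ) • (|x + y| + |x - y|) := by
  rw [le_inv_smul_iff_of_pos two_pos, ← abs_smul_of_nonneg zero_le_two]
  calc |(2 : ℝ) • x| = |(x + y) + (x - y)| := by rw [two_smul, add_add_sub_cancel]
    _ ≤ |x + y| + |x - y| := abs_add_le _ _

theorem posPart_sub_inf_posPart_sub_smul {u v w : V} {a : ℝ} (ha : 0 ≤ a) (hw : w ≤ a • u) :
    (v - u)⁺ ⊓ (w - a • v)⁺ = 0 := by
  have hle : w - a • v ≤ a • (v - u)⁻ :=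
    calc w - a • v ≤ a • u - a • v := sub_le_sub_right hw _
      _ = a • -(v - u) := by rw [neg_sub, smul_sub]
      _ ≤ a • (v - u)⁻ := smul_le_smul_of_nonneg_left (neg_le_negPart _) ha
  exact inf_eq_zero_of_le_smul (posPart_nonneg _) (posPart_nonneg _) (one_smul ℝ (v - u)⁺).ge
    (sup_le hle (smul_nonneg ha (negPart_nonneg _))) (posPart_inf_negPart_eq_zero _)

theorem isDisjointSeq_posPart_sub_sum {u : V} {v : ℕ → V} {a : ℕ → ℝ} (hu : 0 ≤ u)
    (hv : ∀ k, 0 ≤ v k) (ha : ∀ k, 0 ≤ a k) (hvu : ∀ k, v k ≤ a k • u) :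
    IsDisjointSeq fun k => (v k - a k • ∑ i ∈ Finset.range k, v i - u)⁺ := by
  refine isDisjointSeq_of_lt fun i k hik => ?_
  simp only [abs_of_nonneg (posPart_nonneg _)]
  refine inf_eq_zero_of_le (posPart_nonneg _) (posPart_nonneg _) (posPart_mono ?_)
    (posPart_mono ?_) (posPart_sub_inf_posPart_sub_smul (v := v i) (ha k) (hvu k))
  · exact sub_le_sub_right
      (sub_le_self _ (smul_nonneg (ha i) (Finset.sum_nonneg fun j _ => hv j))) u
  · refine (sub_le_self _ hu).trans (sub_le_sub_left ?_ _)
    exact smul_le_smul_of_nonneg_left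
      (Finset.single_le_sum (fun j _ => hv j) (Finset.mem_range.2 hik)) (ha k)

end VectorLattice

namespace BanachLatticeDual

variable {E : Type*} [NormedAddCommGroup E] [Lattice E] [IsOrderedAddMonoid E] [NormedSpace ℝ E]

instance instIsOrderedAddMonoid : IsOrderedAddMonoid (StrongDual ℝ E) where
  add_le_add_left f g h k x hx := by
    simpa only [add_apply] using add_le_add_left (h x hx) (k x)

theorem apply_nonneg {f : StrongDual ℝ E} (hf : 0 ≤ f) {x : E} (hx : 0 ≤ x) : 0 ≤ f x :=
  hf x hx

theorem apply_mono {f : StrongDual ℝ E} (hf : 0 ≤ f) {x y : E} (hxy : x ≤ y) : f x ≤ f y := by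
  simpa only [map_sub, sub_nonneg] using apply_nonneg hf (sub_nonneg.2 hxy)

variable [HasSolidNorm E]

theorem abs_apply_le_of_nonneg (f : StrongDual ℝ E) {x : E} (hx : 0 ≤ x) : |f x| ≤ |f| x :=
  abs_le'.2 ⟨(le_abs_self f : f ≤ |f|) x hx, (neg_le_abs f : -f ≤ |f|) x hx⟩

theorem abs_apply_le (f : StrongDual ℝ E) (x : E) : |f x| ≤ |f| |x| :=
  calc |f x| = |f x⁺ - f x⁻| := by rw [← map_sub, posPart_sub_negPart]
    _ ≤ |f x⁺| + |f x⁻| := abs_sub _ _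
    _ ≤ |f| x⁺ + |f| x⁻ := add_le_add (abs_apply_le_of_nonneg f (posPart_nonneg x))
        (abs_apply_le_of_nonneg f (negPart_nonneg x))
    _ = |f| |x| := by rw [← map_add, posPart_add_negPart]

theorem abs_comp_le (f : StrongDual ℝ E) {P : E →L[ℝ] E} (hP : ∀ x, 0 ≤ x → 0 ≤ P x) :
    |f.comp P| ≤ |f|.comp P :=
  sup_le (fun x hx => (le_abs_self f : f ≤ |f|) _ (hP x hx))
    fun x hx => (neg_le_abs f : -f ≤ |f|) _ (hP x hx)

theorem inf_apply_le (f g : StrongDual ℝ E) {x y : E} (hy : 0 ≤ y) (hyx : y ≤ x) :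
    (f ⊓ g) x ≤ f (x - y) + g y :=
  calc (f ⊓ g) x = (f ⊓ g) (x - y) + (f ⊓ g) y := by rw [← map_add, sub_add_cancel]
    _ ≤ f (x - y) + g y := add_le_add ((inf_le_left : f ⊓ g ≤ f) _ (sub_nonneg.2 hyx))
        ((inf_le_right : f ⊓ g ≤ g) _ hy)

theorem exists_pos_apply_sub_lt (f : StrongDual ℝ E) {x : E} (hx : 0 ≤ x) {δ : ℝ} (hδ : 0 < δ) :
    ∃ y, 0 ≤ y ∧ y ≤ x ∧ pos f x - δ < f y := by
  rw [pos_apply f hx]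
  obtain ⟨_, ⟨y, hy, rfl⟩, hlt⟩ :=
    exists_lt_of_lt_csSup ((Set.nonempty_Icc.2 hx).image f) (sub_lt_self _ hδ)
  exact ⟨y, hy.1, hy.2, hlt⟩

theorem exists_abs_le_lt_apply (f : StrongDual ℝ E) {x : E} (hx : 0 ≤ x) {δ : ℝ} (hδ : 0 < δ) :
    ∃ z, |z| ≤ x ∧ |f| x - δ < f z := by
  obtain ⟨y, hy, hyx, hlt⟩ := exists_pos_apply_sub_lt (-f - f) hx hδ
  have habs : |f| x = f x + pos (-f - f) x := rfl
  refine ⟨x - y - y, abs_le'.2 ⟨?_, ?_⟩, ?_⟩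
  · exact (sub_le_self _ hy).trans (sub_le_self _ hy)
  · rw [neg_sub]
    exact (sub_le_self _ (sub_nonneg.2 hyx)).trans hyx
  · simp only [sub_apply, neg_apply, map_sub] at hlt ⊢
    linarith

theorem exists_add_lt_of_inf_eq_zero {f g : StrongDual ℝ E} (h : f ⊓ g = 0) {x : E} (hx : 0 ≤ x)
    {δ : ℝ} (hδ : 0 < δ) : ∃ y, 0 ≤ y ∧ y ≤ x ∧ f (x - y) + g y < δ := by
  obtain ⟨y, hy, hyx, hlt⟩ := exists_pos_apply_sub_lt (f - g) hx hδ
  have hpos : f x - pos (f - g) x = 0 := DFunLike.congr_fun h x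
  refine ⟨y, hy, hyx, ?_⟩
  simp only [sub_apply, map_sub] at hlt ⊢
  linarith

theorem abs_apply_le_norm_mul (f : StrongDual ℝ E) {x : E} (hx : 0 ≤ x) :
    |f| x ≤ ‖f‖ * ‖x‖ := by
  refine le_of_forall_pos_le_add fun δ hδ => ?_
  obtain ⟨z, hz, hlt⟩ := exists_abs_le_lt_apply f hx hδ
  have hzx : ‖z‖ ≤ ‖x‖ := norm_le_norm_of_abs_le_abs (by rwa [abs_of_nonneg hx])
  linarith [(Real.le_norm_self _).trans (f.le_opNorm_of_le hzx)]

theorem exists_sum_le_forall_sub_lt_abs_apply {f : ℕ → StrongDual ℝ E} (hf : IsDisjointSeq f)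
    (s : Finset ℕ) {x : E} (hx : 0 ≤ x) {δ : ℝ} (hδ : 0 < δ) :
    ∃ v : ℕ → E, (∀ i, 0 ≤ v i) ∧ ∑ i ∈ s, v i ≤ x ∧ ∀ i ∈ s, |f i| x - δ < |f i| (v i) := by
  induction s using Finset.induction_on generalizing x δ with
  | empty =>
    exact ⟨0, fun _ => le_rfl, by simpa only [Finset.sum_empty] using hx, fun i hi => by simp at hi⟩
  | insert j s hj ih =>
    have hne : ∀ i ∈ s, i ≠ j := fun i hi => ne_of_mem_of_not_mem hi hj
    have hdisj : (∑ i ∈ s, |f i|) ⊓ |f j| = 0 := by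
      rw [inf_comm]
      exact inf_sum_eq_zero (abs_nonneg _) fun i hi => hf j i (hne i hi).symm
    obtain ⟨y, hy, hyx, hsplit⟩ := exists_add_lt_of_inf_eq_zero hdisj hx (half_pos hδ)
    obtain ⟨v, hv, hvy, hfv⟩ := ih hy (half_pos hδ)
    have hxy : 0 ≤ x - y := sub_nonneg.2 hyx
    refine ⟨Function.update v j (x - y), fun i => ?_, ?_, fun i hi => ?_⟩
    · obtain rfl | hij := eq_or_ne i j
      · rwa [Function.update_self]
      · rw [Function.update_of_ne hij]
        exact hv i
    · rw [Finset.sum_insert hj, Function.update_self,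
        Finset.sum_congr rfl fun i hi => Function.update_of_ne (hne i hi) _ _]
      exact (add_le_add_right hvy _).trans_eq (sub_add_cancel x y)
    · have hsum : 0 ≤ (∑ i ∈ s, |f i|) (x - y) :=
        apply_nonneg (Finset.sum_nonneg fun i _ => abs_nonneg _) hxy
      obtain rfl | hi := Finset.mem_insert.1 hi
      · rw [Function.update_self, map_sub]
        linarith
      · have hle : |f i| (x - y) ≤ (∑ i ∈ s, |f i|) (x - y) :=
          Finset.single_le_sum (fun i _ => abs_nonneg (f i)) hi (x - y) hxy
        rw [map_sub] at hle
        rw [Function.update_of_ne (hne i hi)]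
        linarith [hfv i hi, apply_nonneg (abs_nonneg (f j)) hy]

theorem exists_mem_exists_infinite_subset_abs_apply_le {f : ℕ → StrongDual ℝ E}
    (hf : IsDisjointSeq f) {x : E} (hx : 0 ≤ x) {C ε η : ℝ} (hC : ∀ n, |f n| x ≤ C) (hε : 0 < ε)
    (hη : 0 < η) {S : Set ℕ} (hS : S.Infinite) :
    ∃ n ∈ S, ∃ v : E, 0 ≤ v ∧ v ≤ x ∧ |f n| x - ε < |f n| v ∧
      ∃ T : Set ℕ, T.Infinite ∧ T ⊆ S ∧ ∀ m ∈ T, n < m ∧ |f m| v ≤ η := by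
  obtain ⟨N, hN⟩ := exists_nat_gt (C / η)
  rw [div_lt_iff₀ hη] at hN
  obtain ⟨s, hsS, hs⟩ := hS.exists_subset_card_eq (N + 1)
  obtain ⟨v, hv, hvx, hfv⟩ := exists_sum_le_forall_sub_lt_abs_apply hf s hx hε
  have hsmall : ∀ m, ∃ i ∈ s, |f m| (v i) ≤ η := fun m => by
    refine Finset.exists_le_of_sum_le (Finset.card_pos.1 (hs.symm ▸ N.succ_pos)) ?_
    rw [← map_sum, Finset.sum_const, hs, nsmul_eq_mul, Nat.cast_add_one]
    linarith [(apply_mono (abs_nonneg (f m)) hvx).trans (hC m)]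
  obtain ⟨i, hi, hinf⟩ : ∃ i ∈ s, {m ∈ S | |f m| (v i) ≤ η}.Infinite := by
    by_contra! hfin
    refine hS ((Set.Finite.biUnion s.finite_toSet hfin).subset fun m hm => ?_)
    obtain ⟨i, hi, hmi⟩ := hsmall m
    exact Set.mem_biUnion hi ⟨hm, hmi⟩
  exact ⟨i, hsS hi, v i, hv i, (Finset.single_le_sum (fun j _ => hv j) hi).trans hvx, hfv i hi,
    {m ∈ S | |f m| (v i) ≤ η} \ Set.Iic i, hinf.sdiff (Set.finite_Iic i), fun m hm => hm.1.1,
    fun m hm => ⟨not_le.1 hm.2, hm.1.2⟩⟩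

theorem exists_strictMono_forall_lt_abs_apply_le {f : ℕ → StrongDual ℝ E} (hf : IsDisjointSeq f)
    {x : E} (hx : 0 ≤ x) {C ε : ℝ} (hC : ∀ n, |f n| x ≤ C) (hε : 0 < ε) {η : ℕ → ℝ}
    (hη : ∀ k, 0 < η k) :
    ∃ φ : ℕ → ℕ, StrictMono φ ∧ ∃ v : ℕ → E, (∀ k, 0 ≤ v k) ∧ (∀ k, v k ≤ x) ∧
      (∀ k, |f (φ k)| x - ε < |f (φ k)| (v k)) ∧ ∀ i k, i < k → |f (φ k)| (v i) ≤ η i := by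
  choose n hn v hv hvx hfv T hT hTS hTη using fun (S : {S : Set ℕ // S.Infinite}) (k : ℕ) =>
    exists_mem_exists_infinite_subset_abs_apply_le hf hx hC hε (hη k) S.2
  let S : ℕ → {S : Set ℕ // S.Infinite} := fun k =>
    Nat.rec ⟨Set.univ, Set.infinite_univ⟩ (fun k S => ⟨T S k, hT S k⟩) k
  have hanti : Antitone fun k => (S k).1 := antitone_nat_of_succ_le fun k => hTS (S k) k
  have hmem : ∀ i k, i < k → n (S k) k ∈ T (S i) i := fun i k hik =>
    hanti (Nat.succ_le_of_lt hik) (hn (S k) k)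
  exact ⟨fun k => n (S k) k,
    strictMono_nat_of_lt_succ fun k => (hTη (S k) k _ (hmem k (k + 1) k.lt_succ_self)).1,
    fun k => v (S k) k, fun k => hv _ _, fun k => hvx _ _, fun k => hfv _ _,
    fun i k hik => (hTη (S i) i _ (hmem i k hik)).2⟩

theorem exists_disjoint_abs_le_lt_apply [IsOrderedModule ℝ E] {f : ℕ → StrongDual ℝ E} {u : E}
    {v : ℕ → E} {a : ℕ → ℝ} {c : ℝ} (hu : 0 ≤ u) (hv : ∀ k, 0 ≤ v k) (ha : ∀ k, 0 ≤ a k)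
    (hvu : ∀ k, v k ≤ a k • u)
    (hf : ∀ k, c + a k * ∑ i ∈ Finset.range k, |f k| (v i) + |f k| u < |f k| (v k)) :
    ∃ z : ℕ → E, IsDisjointSeq z ∧ (∀ k, |z k| ≤ v k) ∧ ∀ k, c < f k (z k) := by
  set w : ℕ → E := fun k => (v k - a k • ∑ i ∈ Finset.range k, v i - u)⁺
  have hw : ∀ k, 0 ≤ w k := fun k => posPart_nonneg _
  have hwv : ∀ k, w k ≤ v k := fun k =>
    sup_le ((sub_le_self _ hu).trans (sub_le_self _ (smul_nonneg (ha k)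
      (Finset.sum_nonneg fun i _ => hv i)))) (hv k)
  have hfw : ∀ k, 0 < |f k| (w k) - c := fun k => by
    have hle := apply_mono (abs_nonneg (f k))
      (le_posPart (v k - a k • ∑ i ∈ Finset.range k, v i - u))
    simp only [map_sub, map_smul, map_sum, smul_eq_mul] at hle
    linarith [hf k]
  choose z hzw hfz using fun k => exists_abs_le_lt_apply (f k) (hw k) (hfw k)
  refine ⟨z, (isDisjointSeq_posPart_sub_sum hu hv ha hvu).of_abs_le fun k =>
    (hzw k).trans (le_abs_self _), fun k => (hzw k).trans (hwv k), fun k => ?_⟩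
  linarith [hfz k]

end BanachLatticeDual

section Normed

variable {E : Type*} [NormedAddCommGroup E] [NormedSpace ℝ E]

theorem isWeakStarNull_iff {f : ℕ → StrongDual ℝ E} :
    IsWeakStarNull f ↔ ∀ x, Tendsto (fun n => f n x) atTop (𝓝 0) :=
  tendsto_iff_forall_eval_tendsto_topDualPairing

theorem IsWeakStarNull.comp_strictMono {f : ℕ → StrongDual ℝ E} (hf : IsWeakStarNull f)
    {φ : ℕ → ℕ} (hφ : StrictMono φ) : IsWeakStarNull (f ∘ φ) :=
  hf.comp hφ.tendsto_atTop

theorem IsWeakStarNull.exists_norm_le [CompleteSpace E] {f : ℕ → StrongDual ℝ E}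
    (hf : IsWeakStarNull f) : ∃ C, ∀ n, ‖f n‖ ≤ C :=
  banach_steinhaus fun x => by
    obtain ⟨C, hC⟩ := (isWeakStarNull_iff.1 hf x).norm.bddAbove_range
    exact ⟨C, fun n => hC ⟨n, rfl⟩⟩

theorem exists_norm_le_of_forall_dual_bounded {ι : Type*} {x : ι → E}
    (h : ∀ f : StrongDual ℝ E, ∃ C, ∀ i, |f (x i)| ≤ C) : ∃ C, ∀ i, ‖x i‖ ≤ C := by
  obtain ⟨C, hC⟩ := banach_steinhaus (g := fun i => NormedSpace.inclusionInDoubleDualLi ℝ (x i)) h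
  exact ⟨C, fun i => by simpa only [LinearIsometry.norm_map] using hC i⟩

theorem IsWeaklyPSummable.comp_injective {p : ℝ} {x : ℕ → E} (hx : IsWeaklyPSummable p x)
    {φ : ℕ → ℕ} (hφ : Function.Injective φ) : IsWeaklyPSummable p (x ∘ φ) := fun f =>
  (hx f).comp_injective hφ

theorem IsWeaklyPSummable.exists_norm_le {p : ℝ} (hp : 0 < p) {x : ℕ → E}
    (hx : IsWeaklyPSummable p x) : ∃ C, ∀ n, ‖x n‖ ≤ C := by
  refine exists_norm_le_of_forall_dual_bounded fun f => ?_
  obtain ⟨C, hC⟩ := (hx f).tendsto_atTop_zero.bddAbove_range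
  have hle : ∀ n, |f (x n)| ^ p ≤ C := fun n => hC ⟨n, rfl⟩
  have hC0 : 0 ≤ C := (Real.rpow_nonneg (abs_nonneg _) p).trans (hle 0)
  exact ⟨C ^ p⁻¹, fun n => (Real.le_rpow_inv_iff_of_pos (abs_nonneg _) hC0 hp).2 (hle n)⟩

theorem IsWeaklyPSummable.exists_norm_sum_smul_le {p : ℝ} (hp : 1 ≤ p) {x : ℕ → E}
    (hx : IsWeaklyPSummable p x) :
    ∃ C, ∀ (s : Finset ℕ) (a b : ℕ → ℝ), (∀ i, 0 ≤ b i) → ∑ i ∈ s, b i ^ p ≤ 1 →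
      (∀ i, |a i| ≤ b i ^ (p - 1)) → ‖∑ i ∈ s, a i • x i‖ ≤ C := by
  suffices h : ∃ C, ∀ t : {t : Finset ℕ × (ℕ → ℝ) × (ℕ → ℝ) // (∀ i, 0 ≤ t.2.2 i) ∧
      ∑ i ∈ t.1, t.2.2 i ^ p ≤ 1 ∧ ∀ i, |t.2.1 i| ≤ t.2.2 i ^ (p - 1)},
      ‖∑ i ∈ t.1.1, t.1.2.1 i • x i‖ ≤ C by
    obtain ⟨C, hC⟩ := h
    exact ⟨C, fun s a b hb hbp hab => hC ⟨(s, a, b), hb, hbp, hab⟩⟩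
  refine exists_norm_le_of_forall_dual_bounded fun f => ⟨1 + ∑' n, |f (x n)| ^ p, ?_⟩
  rintro ⟨⟨s, a, b⟩, hb, hbp, hab⟩
  calc |f (∑ i ∈ s, a i • x i)| = |∑ i ∈ s, a i * f (x i)| := by
        simp only [map_sum, map_smul, smul_eq_mul]
    _ ≤ ∑ i ∈ s, |a i| * |f (x i)| := by
        simpa only [abs_mul] using Finset.abs_sum_le_sum_abs (fun i => a i * f (x i)) s
    _ ≤ ∑ i ∈ s, (b i ^ p + |f (x i)| ^ p) := Finset.sum_le_sum fun i _ =>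
        (mul_le_mul_of_nonneg_right (hab i) (abs_nonneg _)).trans
          (rpow_sub_one_mul_le_add (hb i) (abs_nonneg _) hp)
    _ = ∑ i ∈ s, b i ^ p + ∑ i ∈ s, |f (x i)| ^ p := Finset.sum_add_distrib
    _ ≤ 1 + ∑' n, |f (x n)| ^ p := add_le_add hbp
        ((hx f).sum_le_tsum s fun n _ => Real.rpow_nonneg (abs_nonneg _) p)

theorem IsWeaklyPCompact.isBounded {p : ℝ} (hp : 0 < p) {A : Set E} (hA : IsWeaklyPCompact p A) :
    Bornology.IsBounded A := by
  by_contra hcon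
  have hunbdd : ∀ n : ℕ, ∃ x ∈ A, (n : ℝ) < ‖x‖ := by
    simpa only [isBounded_iff_forall_norm_le, not_exists, not_forall, exists_prop, not_le] using
      fun n : ℕ => not_exists.1 (mt isBounded_iff_forall_norm_le.2 hcon) n
  choose x hxA hx using hunbdd
  obtain ⟨a, -, φ, hφ, hsum⟩ := hA x hxA
  obtain ⟨C, hC⟩ := hsum.exists_norm_le hp
  obtain ⟨n, hn⟩ := exists_nat_ge (C + ‖a‖)
  have hlarge : C + ‖a‖ < ‖x (φ n)‖ :=
    hn.trans_lt ((Nat.cast_le.2 (hφ.id_le n)).trans_lt (hx (φ n)))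
  linarith [hC n, norm_le_norm_sub_add (x (φ n)) a]

theorem IsWeaklyPSummable.isWeaklyPCompact_insert_zero_range {p : ℝ} (hp : 0 < p) {x : ℕ → E}
    (hx : IsWeaklyPSummable p x) : IsWeaklyPCompact p (insert 0 (Set.range x)) := by
  let x' : ℕ → E := fun n => Nat.casesOn n 0 x
  have hrange : insert 0 (Set.range x) = Set.range x' := by
    simpa only [Set.insert_eq] using (Nat.range_casesOn (0 : E) x).symm
  have hx' : IsWeaklyPSummable p x' := fun f => (summable_nat_add_iff 1).1 (hx f)
  rw [hrange]
  intro y hy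
  choose m hm using hy
  obtain ⟨φ, hφ, ⟨j, hj⟩ | hmφ⟩ := exists_strictMono_const_or_strictMono_comp m
  · refine ⟨x' j, ⟨j, rfl⟩, φ, hφ, fun f => ?_⟩
    simp only [← hm, hj, sub_self, map_zero, abs_zero, Real.zero_rpow hp.ne', summable_zero]
  · refine ⟨0, ⟨0, rfl⟩, φ, hφ, ?_⟩
    simpa only [← hm, sub_zero, Function.comp_def] using hx'.comp_injective hmφ.injective

theorem isLimitedSet_range {x : ℕ → E}
    (h : ∀ f : ℕ → StrongDual ℝ E, IsWeakStarNull f → ∀ φ : ℕ → ℕ, StrictMono φ →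
      Tendsto (fun n => f n (x (φ n))) atTop (𝓝 0)) : IsLimitedSet (Set.range x) := by
  refine fun f hf => tendstoUniformlyOn_zero_iff_forall_seq.2 fun a ha => ?_
  choose m hm using ha
  simp only [← hm]
  refine tendsto_zero_of_forall_strictMono_exists_abs_lt fun ε hε φ hφ => ?_
  obtain ⟨ψ, hψ, hmψ⟩ := exists_strictMono_const_or_strictMono_comp (m ∘ φ)
  have hfψ := hf.comp_strictMono (hφ.comp hψ)
  have hlim : Tendsto (fun n => f (φ (ψ n)) (x (m (φ (ψ n))))) atTop (𝓝 0) := by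
    obtain ⟨j, hj⟩ | hmψ := hmψ
    · simp only [Function.comp_apply] at hj
      simpa only [hj, Function.comp_apply] using isWeakStarNull_iff.1 hfψ (x j)
    · exact h _ hfψ _ hmψ
  rw [tendsto_zero_iff_abs_tendsto_zero] at hlim
  obtain ⟨k, hk⟩ := (hlim.eventually_lt_const hε).exists
  exact ⟨ψ k, hk⟩

end Normed

section BanachLattice

open BanachLatticeDual

variable {E : Type*} [NormedAddCommGroup E] [NormedSpace ℝ E] [Lattice E]

/-- `P` is the band projection onto the principal band generated by `u ≥ 0`, characterised on the
positive cone by `P x = sup_k (x ⊓ k u)`. -/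
def IsBandProjection (u : E) (P : E →L[ℝ] E) : Prop :=
  ∀ x, 0 ≤ x → IsLUB (Set.range fun k : ℕ => x ⊓ k • u) (P x)

namespace IsBandProjection

variable {u v : E} {P Q : E →L[ℝ] E}

theorem inf_nsmul_le (hP : IsBandProjection u P) {x : E} (hx : 0 ≤ x) (k : ℕ) :
    x ⊓ k • u ≤ P x :=
  (hP x hx).1 ⟨k, rfl⟩

theorem apply_le (hP : IsBandProjection u P) {x : E} (hx : 0 ≤ x) : P x ≤ x :=
  (hP x hx).2 (Set.forall_mem_range.2 fun _ => inf_le_left)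

theorem apply_nonneg (hP : IsBandProjection u P) {x : E} (hx : 0 ≤ x) : 0 ≤ P x := by
  simpa only [zero_nsmul, inf_of_le_right hx] using hP.inf_nsmul_le hx 0

theorem apply_eq_self_of_le (hP : IsBandProjection u P) {x : E} (hx : 0 ≤ x) (hxu : x ≤ u) :
    P x = x :=
  le_antisymm (hP.apply_le hx) (by
    simpa only [one_nsmul, inf_of_le_left hxu] using hP.inf_nsmul_le hx 1)

theorem apply_apply (hP : IsBandProjection u P) {x : E} (hx : 0 ≤ x) : P (P x) = P x := by
  have hPx := hP.apply_nonneg hx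
  refine le_antisymm (hP.apply_le hPx) ((hP x hx).2 (Set.forall_mem_range.2 fun k => ?_))
  exact (le_inf (hP.inf_nsmul_le hx k) inf_le_right).trans (hP.inf_nsmul_le hPx k)

variable [IsOrderedAddMonoid E]

theorem apply_eq_self_of_abs_le (hP : IsBandProjection u P) {x : E} (hxu : |x| ≤ u) :
    P x = x := by
  have hpos : x⁺ ≤ u := (sup_le (le_abs_self x) (abs_nonneg x)).trans hxu
  have hneg : x⁻ ≤ u := (sup_le (neg_le_abs x) (abs_nonneg x)).trans hxu
  rw [← posPart_sub_negPart x, map_sub, hP.apply_eq_self_of_le (posPart_nonneg x) hpos,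
    hP.apply_eq_self_of_le (negPart_nonneg x) hneg]

variable [IsOrderedModule ℝ E]

theorem inf_eq_zero (hP : IsBandProjection u P) (hQ : IsBandProjection v Q) (huv : u ⊓ v = 0)
    {x y : E} (hx : 0 ≤ x) (hy : 0 ≤ y) : P x ⊓ Q y = 0 := by
  have hu : 0 ≤ u := huv.symm.trans_le inf_le_left
  have hv : 0 ≤ v := huv.symm.trans_le inf_le_right
  refine inf_eq_zero_of_isLUB (Set.range_nonempty _) (hQ y hy) (Set.forall_mem_range.2 fun k => ?_)
  rw [inf_comm]
  refine inf_eq_zero_of_isLUB (Set.range_nonempty _) (hP x hx) (Set.forall_mem_range.2 fun j => ?_)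
  rw [inf_comm]
  refine inf_eq_zero_of_le_smul (r := j) (s := k) (le_inf hx (nsmul_nonneg hu j))
    (le_inf hy (nsmul_nonneg hv k)) ?_ ?_ huv
  all_goals
    rw [Nat.cast_smul_eq_nsmul]
    exact inf_le_right

theorem apply_apply_eq_zero (hP : IsBandProjection u P) (hQ : IsBandProjection v Q)
    (huv : u ⊓ v = 0) {x : E} (hx : 0 ≤ x) : Q (P x) = 0 := by
  have hPx := hP.apply_nonneg hx
  rw [← hP.inf_eq_zero hQ huv hx hPx, inf_of_le_right (hQ.apply_le hPx)]

theorem abs_comp_inf_abs_comp [HasSolidNorm E] (hP : IsBandProjection u P)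
    (hQ : IsBandProjection v Q) (huv : u ⊓ v = 0) (f g : StrongDual ℝ E) :
    |f.comp P| ⊓ |g.comp Q| = 0 := by
  refine inf_eq_zero_of_le (abs_nonneg _) (abs_nonneg _) (abs_comp_le f fun x => hP.apply_nonneg)
    (abs_comp_le g fun x => hQ.apply_nonneg) (le_antisymm (fun x hx => ?_) (le_inf ?_ ?_))
  · refine (inf_apply_le _ _ (hP.apply_nonneg hx) (hP.apply_le hx)).trans_eq ?_
    simp only [ContinuousLinearMap.comp_apply, map_sub, hP.apply_apply hx,
      hP.apply_apply_eq_zero hQ huv hx, sub_self, map_zero, add_zero, zero_apply]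
  · exact fun x hx => BanachLatticeDual.apply_nonneg (abs_nonneg f) (hP.apply_nonneg hx)
  · exact fun x hx => BanachLatticeDual.apply_nonneg (abs_nonneg g) (hQ.apply_nonneg hx)

end IsBandProjection

variable [IsOrderedAddMonoid E]

theorem isWeakStarNull_of_nonneg {f : ℕ → StrongDual ℝ E}
    (h : ∀ x, 0 ≤ x → Tendsto (fun n => f n x) atTop (𝓝 0)) : IsWeakStarNull f :=
  isWeakStarNull_iff.2 fun x => by
    simpa only [← map_sub, posPart_sub_negPart, sub_zero] using
      (h _ (posPart_nonneg x)).sub (h _ (negPart_nonneg x))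

variable [HasSolidNorm E]

theorem exists_abs_apply_lt_of_disjoint_of_nonneg [CompleteSpace E] (hE : IsSigmaDedekindComplete E)
    {f : ℕ → StrongDual ℝ E} (hf : IsWeakStarNull f) {x : E} {z : ℕ → E} (hz : IsDisjointSeq z)
    (hz0 : ∀ n, 0 ≤ z n) (hzx : ∀ n, z n ≤ x) {ε : ℝ} (hε : 0 < ε) : ∃ n, |f n (z n)| < ε := by
  obtain ⟨Z, hZz, hZ0, hZx, hZadd⟩ := exists_additive_apply_singleton_eq hE hz hz0 hzx
  obtain ⟨C, hC⟩ := hf.exists_norm_le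
  have hmono : ∀ n, Monotone fun A => |f n| (Z A) := fun n A B hAB => by
    refine apply_mono (abs_nonneg (f n)) ?_
    rw [← Set.union_sdiff_cancel hAB, hZadd _ _ Set.disjoint_sdiff_right]
    exact le_add_of_nonneg_right (hZ0 _)
  have hbound : ∀ n, |f n| (Z Set.univ) ≤ C * ‖x‖ := fun n => by
    have hx : 0 ≤ x := (hz0 0).trans (hzx 0)
    exact ((apply_mono (abs_nonneg (f n)) (hZx _)).trans (abs_apply_le_norm_mul _ hx)).trans
      (mul_le_mul_of_nonneg_right (hC n) (norm_nonneg x))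
  obtain ⟨M, hM, hMε⟩ := exists_infinite_forall_diff_singleton_lt hmono
    (fun n A B hAB => by rw [hZadd A B hAB, map_add]) hbound (half_pos hε)
  have hlim : Tendsto (fun n => |f n (Z M)|) atTop (𝓝 0) :=
    (tendsto_zero_iff_abs_tendsto_zero _).1 (isWeakStarNull_iff.1 hf (Z M))
  obtain ⟨n, hnM, hn⟩ := ((Nat.frequently_atTop_iff_infinite.2 hM).and_eventually
    (hlim.eventually_lt_const (half_pos hε))).exists
  have hsplit : f n (z n) = f n (Z M) - f n (Z (M \ {n})) := by
    rw [eq_sub_iff_add_eq, ← hZz, ← map_add, ← hZadd _ _ Set.disjoint_sdiff_right,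
      Set.union_sdiff_cancel (Set.singleton_subset_iff.2 hnM)]
  refine ⟨n, ?_⟩
  calc |f n (z n)| ≤ |f n (Z M)| + |f n (Z (M \ {n}))| := hsplit ▸ abs_sub _ _
    _ ≤ |f n (Z M)| + |f n| (Z (M \ {n})) := by
        gcongr
        exact abs_apply_le_of_nonneg _ (hZ0 _)
    _ < ε / 2 + ε / 2 := add_lt_add hn (hMε n hnM)
    _ = ε := add_halves ε

theorem tendsto_apply_of_disjoint_of_nonneg [CompleteSpace E] (hE : IsSigmaDedekindComplete E)
    {f : ℕ → StrongDual ℝ E} (hf : IsWeakStarNull f) {x : E} {z : ℕ → E} (hz : IsDisjointSeq z)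
    (hz0 : ∀ n, 0 ≤ z n) (hzx : ∀ n, z n ≤ x) : Tendsto (fun n => f n (z n)) atTop (𝓝 0) :=
  tendsto_zero_of_forall_strictMono_exists_abs_lt fun _ hε _ hφ =>
    exists_abs_apply_lt_of_disjoint_of_nonneg hE (hf.comp_strictMono hφ)
      (hz.comp_injective hφ.injective) (fun _ => hz0 _) (fun _ => hzx _) hε

theorem tendsto_apply_of_disjoint_of_abs_le [CompleteSpace E] (hE : IsSigmaDedekindComplete E)
    {f : ℕ → StrongDual ℝ E} (hf : IsWeakStarNull f) {x : E} {z : ℕ → E} (hz : IsDisjointSeq z)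
    (hzx : ∀ n, |z n| ≤ x) : Tendsto (fun n => f n (z n)) atTop (𝓝 0) := by
  have hpos : ∀ n, (z n)⁺ ≤ |z n| := fun n => sup_le (le_abs_self _) (abs_nonneg _)
  have hneg : ∀ n, (z n)⁻ ≤ |z n| := fun n => sup_le (neg_le_abs _) (abs_nonneg _)
  have hlim_pos := tendsto_apply_of_disjoint_of_nonneg hE hf
    (hz.of_abs_le fun n => (abs_of_nonneg (posPart_nonneg (z n))).trans_le (hpos n))
    (fun n => posPart_nonneg _) fun n => (hpos n).trans (hzx n)
  have hlim_neg := tendsto_apply_of_disjoint_of_nonneg hE hf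
    (hz.of_abs_le fun n => (abs_of_nonneg (negPart_nonneg (z n))).trans_le (hneg n))
    (fun n => negPart_nonneg _) fun n => (hneg n).trans (hzx n)
  simpa only [← map_sub, posPart_sub_negPart, sub_zero] using hlim_pos.sub hlim_neg

theorem exists_continuousLinearMap_of_additive_on_cone {F : Type*} [NormedAddCommGroup F]
    [NormedSpace ℝ F] {L : E → F} {C : ℝ} (hadd : ∀ x y, 0 ≤ x → 0 ≤ y → L (x + y) = L x + L y)
    (hL : ∀ x, 0 ≤ x → ‖L x‖ ≤ C * ‖x‖) : ∃ T : E →L[ℝ] F, ∀ x, 0 ≤ x → T x = L x := by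
  have hsub : ∀ x y a b : E, 0 ≤ x → 0 ≤ y → 0 ≤ a → 0 ≤ b → x - y = a - b →
      L x - L y = L a - L b := fun x y a b hx hy ha hb h => by
    rw [sub_eq_sub_iff_add_eq_add] at h ⊢
    rw [← hadd x b hx hb, h, hadd a y ha hy]
  let T : E →+ F :=
    { toFun := fun x => L x⁺ - L x⁻
      map_zero' := by rw [posPart_zero, negPart_zero, sub_self]
      map_add' := fun x y => by
        rw [hsub (x + y)⁺ (x + y)⁻ (x⁺ + y⁺) (x⁻ + y⁻) (posPart_nonneg _) (negPart_nonneg _)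
            (add_nonneg (posPart_nonneg _) (posPart_nonneg _))
            (add_nonneg (negPart_nonneg _) (negPart_nonneg _)),
          hadd _ _ (posPart_nonneg _) (posPart_nonneg _),
          hadd _ _ (negPart_nonneg _) (negPart_nonneg _), add_sub_add_comm]
        simp only [posPart_sub_negPart, add_sub_add_comm] }
  have hbound : ∀ x z : E, 0 ≤ z → z ≤ |x| → ‖L z‖ ≤ |C| * ‖x‖ := fun x z hz hzx =>
    calc ‖L z‖ ≤ C * ‖z‖ := hL z hz
      _ ≤ |C| * ‖x‖ := mul_le_mul (le_abs_self C)
          (norm_le_norm_of_abs_le_abs (by rwa [abs_of_nonneg hz])) (norm_nonneg z) (abs_nonneg C)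
  refine ⟨T.toRealLinearMap (AddMonoidHomClass.continuous_of_bound T (|C| + |C|) fun x => ?_),
    fun x hx => ?_⟩
  · rw [add_mul]
    exact (norm_sub_le _ _).trans (add_le_add
      (hbound x _ (posPart_nonneg x) (sup_le (le_abs_self x) (abs_nonneg x)))
      (hbound x _ (negPart_nonneg x) (sup_le (neg_le_abs x) (abs_nonneg x))))
  · have hL0 : L 0 = 0 := by simpa only [add_zero, left_eq_add] using hadd 0 0 le_rfl le_rfl
    change L x⁺ - L x⁻ = L x
    rw [posPart_of_nonneg hx, negPart_of_nonneg hx, hL0, sub_zero]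

theorem exists_isBandProjection (hE : IsSigmaDedekindComplete E) {u : E} (hu : 0 ≤ u) :
    ∃ P, IsBandProjection u P := by
  have hlub : ∀ x : E, ∃ a, IsLUB (Set.range fun k : ℕ => x ⊓ k • u) a := fun x =>
    hE _ (Set.range_nonempty _) (Set.countable_range _)
      ⟨x, Set.forall_mem_range.2 fun _ => inf_le_left⟩
  choose L hL using hlub
  have hle : ∀ (x : E) (k : ℕ), x ⊓ k • u ≤ L x := fun x k => (hL x).1 ⟨k, rfl⟩
  have hLle : ∀ {x c : E}, (∀ k : ℕ, x ⊓ k • u ≤ c) → L x ≤ c := fun h =>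
    (hL _).2 (Set.forall_mem_range.2 h)
  have hadd : ∀ x y, 0 ≤ x → 0 ≤ y → L (x + y) = L x + L y := by
    refine fun x y hx hy => le_antisymm ?_ ?_
    · exact hLle fun k => (add_inf_le_inf_add_inf hx hy (nsmul_nonneg hu k)).trans
        (add_le_add (hle x k) (hle y k))
    · refine le_sub_iff_add_le.1 (hLle fun j => le_sub_comm.1 (hLle fun k => ?_))
      rw [le_sub_iff_add_le']
      refine le_trans (le_inf (add_le_add inf_le_left inf_le_left) ?_) (hle (x + y) (j + k))
      rw [add_nsmul]
      exact add_le_add inf_le_right inf_le_right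
  have hnorm : ∀ x, 0 ≤ x → ‖L x‖ ≤ 1 * ‖x‖ := fun x hx => by
    have hLx : 0 ≤ L x := (le_inf hx (nsmul_nonneg hu 0)).trans (hle x 0)
    rw [one_mul]
    exact norm_le_norm_of_abs_le_abs
      (by rw [abs_of_nonneg hLx, abs_of_nonneg hx]; exact hLle fun _ => inf_le_left)
  obtain ⟨P, hP⟩ := exists_continuousLinearMap_of_additive_on_cone hadd hnorm
  exact ⟨P, fun x hx => hP x hx ▸ hL x⟩

variable [IsOrderedModule ℝ E]

theorem exists_forall_abs_le_norm_le {ι : Type*} {X : ι → E} {C : ℝ} (s : Finset ι) {y : E}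
    (h : ∀ σ : ι → ℝ, (∀ i, |σ i| ≤ 1) → ‖y + ∑ i ∈ s, σ i • X i‖ ≤ C) :
    ∃ V, |y| ≤ V ∧ (∀ i ∈ s, |X i| ≤ V) ∧ ‖V‖ ≤ C := by
  classical
  induction s using Finset.induction_on generalizing y with
  | empty =>
    refine ⟨|y|, le_rfl, fun i hi => absurd hi (Finset.notMem_empty i), ?_⟩
    simpa only [Finset.sum_empty, add_zero, norm_abs_eq_norm] using
      h 0 fun _ => by simp only [Pi.zero_apply, abs_zero, zero_le_one]
  | insert j s hj ih =>
    have hsigned : ∀ r : ℝ, |r| ≤ 1 → ∀ σ : ι → ℝ, (∀ i, |σ i| ≤ 1) →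
        ‖y + r • X j + ∑ i ∈ s, σ i • X i‖ ≤ C := fun r hr σ hσ => by
      have hle := h (Function.update σ j r)
        ((Function.forall_update_iff σ fun _ t => |t| ≤ 1).2 ⟨hr, fun i _ => hσ i⟩)
      rwa [Finset.sum_insert hj, Function.update_self, ← add_assoc, Finset.sum_congr rfl fun i hi =>
        by rw [Function.update_of_ne (ne_of_mem_of_not_mem hi hj)]] at hle
    obtain ⟨V, hyV, hXV, hVC⟩ := ih (hsigned 1 (by norm_num))
    obtain ⟨W, hyW, hXW, hWC⟩ := ih (hsigned (-1) (by norm_num))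
    rw [one_smul] at hyV
    rw [neg_one_smul, ← sub_eq_add_neg] at hyW
    have hmean : ∀ a b : E, a ≤ V → b ≤ W → (2⁻¹ : ℝ) • (a + b) ≤ (2⁻¹ : ℝ) • (V + W) :=
      fun a b ha hb => smul_le_smul_of_nonneg_left (add_le_add ha hb) (by norm_num)
    refine ⟨(2⁻¹ : ℝ) • (V + W), ?_, Finset.forall_mem_insert _ _ _ |>.2 ⟨?_, fun i hi => ?_⟩, ?_⟩
    · exact (abs_le_half_smul_abs_add_add_abs_sub y (X j)).trans (hmean _ _ hyV hyW)
    · rw [add_comm] at hyV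
      rw [abs_sub_comm] at hyW
      exact (abs_le_half_smul_abs_add_add_abs_sub (X j) y).trans (hmean _ _ hyV hyW)
    · simpa only [← two_smul ℝ, inv_smul_smul₀ (two_ne_zero' ℝ)] using
        hmean _ _ (hXV i hi) (hXW i hi)
    · rw [norm_smul, Real.norm_of_nonneg (by norm_num)]
      linarith [norm_add_le V W]

theorem IsWeaklyPSummable.of_disjoint_of_abs_le {p : ℝ} (hp : 1 ≤ p) {x y : ℕ → E}
    (hx : IsWeaklyPSummable p x) (hy : IsDisjointSeq y) (hyx : ∀ n, |y n| ≤ |x n|) :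
    IsWeaklyPSummable p y := by
  intro f
  obtain ⟨C, hC⟩ := hx.exists_norm_sum_smul_le hp
  have hsummable : Summable fun n => |f| |y n| ^ p := by
    refine summable_rpow_of_forall_sum_rpow_sub_one_mul_le (K := ‖f‖ * C) (by linarith)
      (fun n => apply_nonneg (abs_nonneg f) (abs_nonneg _)) fun s b hb hbp => ?_
    have hb' : ∀ i, 0 ≤ b i ^ (p - 1) := fun i => Real.rpow_nonneg (hb i) _
    have hby : ∀ i, 0 ≤ b i ^ (p - 1) • |y i| := fun i => smul_nonneg (hb' i) (abs_nonneg _)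
    obtain ⟨V, hV0, hV, hVC⟩ := exists_forall_abs_le_norm_le (X := fun i => b i ^ (p - 1) • x i)
      (y := 0) (C := C) s fun σ hσ => by
        simpa only [zero_add, smul_smul] using hC s (fun i => σ i * b i ^ (p - 1)) b hb hbp fun i =>
          by simpa only [abs_mul, abs_of_nonneg (hb' i)] using mul_le_of_le_one_left (hb' i) (hσ i)
    rw [abs_zero] at hV0
    have hyV : ∑ i ∈ s, b i ^ (p - 1) • |y i| ≤ V := by
      refine sum_le_of_pairwise_inf_eq_zero hV0 (fun i _ => hby i) (fun i _ j _ hij => ?_)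
        fun i hi => ?_
      · exact inf_eq_zero_of_le_smul (hby i) (hby j) le_rfl le_rfl (hy i j hij)
      · refine (smul_le_smul_of_nonneg_left (hyx i) (hb' i)).trans ?_
        exact (abs_smul_of_nonneg (hb' i) (x i)).symm.trans_le (hV i hi)
    calc ∑ i ∈ s, b i ^ (p - 1) * |f| |y i| = |f| (∑ i ∈ s, b i ^ (p - 1) • |y i|) := by
          simp only [map_sum, map_smul, smul_eq_mul]
      _ ≤ |f| V := apply_mono (abs_nonneg f) hyV
      _ ≤ ‖f‖ * ‖V‖ := abs_apply_le_norm_mul f hV0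
      _ ≤ ‖f‖ * C := mul_le_mul_of_nonneg_left hVC (norm_nonneg f)
  exact hsummable.of_nonneg_of_le (fun n => Real.rpow_nonneg (abs_nonneg _) p) fun n =>
    Real.rpow_le_rpow (abs_nonneg _) (abs_apply_le f (y n)) (by linarith)

variable [CompleteSpace E]

theorem exists_disjoint_isWeakStarNull_apply_eq (hE : IsSigmaDedekindComplete E)
    {f : ℕ → StrongDual ℝ E} (hf : IsWeakStarNull f) {x : ℕ → E} (hx : IsDisjointSeq x) :
    ∃ g : ℕ → StrongDual ℝ E, IsDisjointSeq g ∧ IsWeakStarNull g ∧ ∀ n, g n (x n) = f n (x n) := by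
  choose P hP using fun n => exists_isBandProjection hE (abs_nonneg (x n))
  refine ⟨fun n => (f n).comp (P n), fun m n hmn => ?_, isWeakStarNull_of_nonneg fun y hy => ?_,
    fun n => ?_⟩
  · exact (hP m).abs_comp_inf_abs_comp (hP n) (hx m n hmn) (f m) (f n)
  · have hP0 : ∀ n, |P n y| = P n y := fun n => abs_of_nonneg ((hP n).apply_nonneg hy)
    refine tendsto_apply_of_disjoint_of_abs_le hE hf (fun m n hmn => ?_)
      fun n => (hP0 n).trans_le ((hP n).apply_le hy)
    change |P m y| ⊓ |P n y| = 0
    rw [hP0, hP0]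
    exact (hP m).inf_eq_zero (hP n) (hx m n hmn) hy hy
  · rw [ContinuousLinearMap.comp_apply, (hP n).apply_eq_self_of_abs_le le_rfl]

theorem HasPWeakDPStar.hasDisjointDPStar (hE : IsSigmaDedekindComplete E) {p : ℝ} (hp : 0 < p)
    (h : HasPWeakDPStar E p) : HasDisjointDPStar E p := by
  refine fun x hx hsum => isLimitedSet_range fun f hf φ hφ => ?_
  obtain ⟨g, hg, hg0, hgx⟩ :=
    exists_disjoint_isWeakStarNull_apply_eq hE hf (hx.comp_injective hφ.injective)
  have hlim := tendstoUniformlyOn_zero_iff_forall_seq.1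
    ((h _ (hsum.isWeaklyPCompact_insert_zero_range hp)).2 g hg hg0) _
    fun n => Set.mem_insert_of_mem _ ⟨φ n, rfl⟩
  exact hlim.congr hgx

theorem exists_abs_apply_lt_of_disjoint (hE : IsSigmaDedekindComplete E)
    {f : ℕ → StrongDual ℝ E} (hf : IsDisjointSeq f) (hf0 : IsWeakStarNull f) {x : E} (hx : 0 ≤ x)
    {ε : ℝ} (hε : 0 < ε) : ∃ n, |f n| x < ε := by
  by_contra! hle
  obtain ⟨C, hC⟩ := hf0.exists_norm_le
  have hfx : ∀ n, |f n| x ≤ C * ‖x‖ := fun n => (abs_apply_le_norm_mul (f n) hx).trans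
    (mul_le_mul_of_nonneg_right (hC n) (norm_nonneg x))
  obtain ⟨β, hβ, hβε⟩ := exists_pos_mul_lt (by positivity : 0 < ε / 8) (C * ‖x‖)
  obtain ⟨φ, hφ, v, hv, hvx, hfv, hfv'⟩ := exists_strictMono_forall_lt_abs_apply_le hf hx hfx
    (half_pos hε) (η := fun i => ε / 16 * β * (1 / 2) ^ i) (fun i => by positivity)
  have hsum : ∀ k, β⁻¹ * ∑ i ∈ Finset.range k, |f (φ k)| (v i) ≤ ε / 8 := fun k =>
    calc β⁻¹ * ∑ i ∈ Finset.range k, |f (φ k)| (v i)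
        ≤ β⁻¹ * ∑ i ∈ Finset.range k, ε / 16 * β * (1 / 2 : ℝ) ^ i := by
          gcongr with i hi
          exact hfv' i k (Finset.mem_range.1 hi)
      _ = ε / 16 * ∑ i ∈ Finset.range k, (1 / 2 : ℝ) ^ i := by
          rw [← Finset.mul_sum]
          field_simp
      _ ≤ ε / 16 * 2 := by
          gcongr
          exact sum_geometric_two_le k
      _ = ε / 8 := by ring
  obtain ⟨z, hz, hzv, hfz⟩ := exists_disjoint_abs_le_lt_apply (f := f ∘ φ) (u := β • x)
    (a := fun _ => β⁻¹) (c := ε / 8) (smul_nonneg hβ.le hx) hv (fun _ => by positivity)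
    (fun k => by simpa only [inv_smul_smul₀ hβ.ne'] using hvx k) (fun k => by
      have hu : |f (φ k)| (β • x) < ε / 8 := by
        rw [map_smul, smul_eq_mul, mul_comm]
        exact (mul_le_mul_of_nonneg_right (hfx _) hβ.le).trans_lt hβε
      simp only [Function.comp_apply]
      linarith [hsum k, hfv k, hle (φ k)])
  have hlim := tendsto_apply_of_disjoint_of_abs_le hE (hf0.comp_strictMono hφ) hz
    fun k => (hzv k).trans (hvx k)
  linarith [ge_of_tendsto' hlim fun k => (hfz k).le]

theorem tendsto_abs_apply_of_disjoint (hE : IsSigmaDedekindComplete E)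
    {f : ℕ → StrongDual ℝ E} (hf : IsDisjointSeq f) (hf0 : IsWeakStarNull f) {x : E} (hx : 0 ≤ x) :
    Tendsto (fun n => |f n| x) atTop (𝓝 0) :=
  tendsto_zero_of_forall_strictMono_exists_abs_lt fun _ hε φ hφ => by
    simpa only [abs_of_nonneg (apply_nonneg (abs_nonneg _) hx), Function.comp_apply] using
      exists_abs_apply_lt_of_disjoint hE (hf.comp_injective hφ.injective) (hf0.comp_strictMono hφ)
        hx hε

theorem exists_forall_le_two_pow_smul {v : ℕ → E} {B : ℝ} (hv : ∀ k, 0 ≤ v k)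
    (hB : ∀ k, ‖v k‖ ≤ B) : ∃ u, 0 ≤ u ∧ ‖u‖ ≤ 2 * B ∧ ∀ k, v k ≤ (2 : ℝ) ^ k • u := by
  have hbound : ∀ k, ‖(1 / 2 : ℝ) ^ k • v k‖ ≤ (1 / 2 : ℝ) ^ k * B := fun k => by
    rw [norm_smul, Real.norm_of_nonneg (by positivity)]
    exact mul_le_mul_of_nonneg_left (hB k) (by positivity)
  have hgeom : HasSum (fun k => (1 / 2 : ℝ) ^ k * B) (2 * B) := hasSum_geometric_two.mul_right B
  have hnonneg : ∀ k, 0 ≤ (1 / 2 : ℝ) ^ k • v k := fun k => smul_nonneg (by positivity) (hv k)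
  refine ⟨∑' k, (1 / 2 : ℝ) ^ k • v k, tsum_nonneg hnonneg, tsum_of_norm_bounded hgeom hbound,
    fun k => ?_⟩
  rw [← inv_smul_le_iff_of_pos (by positivity), ← inv_pow, ← one_div]
  exact (Summable.of_norm_bounded hgeom.summable hbound).le_tsum k fun j _ => hnonneg j

theorem exists_strictMono_exists_disjoint_abs_le {f : ℕ → StrongDual ℝ E} {v : ℕ → E} {B C ε : ℝ}
    (hv : ∀ k, 0 ≤ v k) (hB : ∀ k, ‖v k‖ ≤ B) (hC : ∀ k, ‖f k‖ ≤ C) (hε : 0 < ε)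
    (hf : ∀ m, Tendsto (fun n => |f n| (v m)) atTop (𝓝 0)) (hfv : ∀ n, ε ≤ |f n| (v n)) :
    ∃ φ : ℕ → ℕ, StrictMono φ ∧ ∃ z : ℕ → E, IsDisjointSeq z ∧ (∀ k, |z k| ≤ v (φ k)) ∧
      ∀ k, ε / 4 < f (φ k) (z k) := by
  have hC0 : 0 ≤ C := (norm_nonneg _).trans (hC 0)
  obtain ⟨β, hβ, hβε⟩ := exists_pos_mul_lt (by positivity : 0 < ε / 4) (C * (2 * B))
  let a : ℕ → ℝ := fun k => 2 ^ k * β⁻¹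
  have ha : ∀ k, 0 < a k := fun k => by positivity
  obtain ⟨φ, hφ, hfφ⟩ := exists_strictMono_forall_lt_lt hf
    (η := fun k => ε / 4 / (a k * (k + 1))) fun k => div_pos (by positivity)
      (mul_pos (ha k) (by positivity))
  obtain ⟨u, hu, huB, hvu⟩ := exists_forall_le_two_pow_smul (fun k => hv (φ k)) fun k => hB (φ k)
  have hsum : ∀ k, a k * ∑ i ∈ Finset.range k, |f (φ k)| (v (φ i)) ≤ ε / 4 := fun k =>
    calc a k * ∑ i ∈ Finset.range k, |f (φ k)| (v (φ i))
        ≤ a k * ∑ _i ∈ Finset.range k, ε / 4 / (a k * (k + 1)) := by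
          gcongr with i hi
          exact (hfφ i k (Finset.mem_range.1 hi)).le
      _ = ε / 4 * (k / (k + 1)) := by
          have hak := (ha k).ne'
          rw [Finset.sum_const, Finset.card_range, nsmul_eq_mul]
          field_simp
      _ ≤ ε / 4 := mul_le_of_le_one_right (by positivity)
          ((div_le_one (by positivity)).2 (le_add_of_nonneg_right zero_le_one))
  have hβu : ∀ k, |f (φ k)| (β • u) < ε / 4 := fun k =>
    calc |f (φ k)| (β • u) = |f (φ k)| u * β := by rw [map_smul, smul_eq_mul, mul_comm]
      _ ≤ C * (2 * B) * β := by
          gcongr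
          exact (abs_apply_le_norm_mul _ hu).trans (mul_le_mul (hC _) huB (norm_nonneg u) hC0)
      _ < ε / 4 := hβε
  refine ⟨φ, hφ, exists_disjoint_abs_le_lt_apply (f := f ∘ φ) (u := β • u) (smul_nonneg hβ.le hu)
    (fun k => hv (φ k)) (fun k => (ha k).le) (fun k => ?_) fun k => ?_⟩
  · rw [mul_smul, inv_smul_smul₀ hβ.ne']
    exact hvu k
  · simp only [Function.comp_apply]
    linarith [hsum k, hβu k, hfv (φ k)]

theorem HasDisjointDPStar.exists_abs_apply_lt (hE : IsSigmaDedekindComplete E) {p : ℝ} (hp : 1 ≤ p)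
    (h : HasDisjointDPStar E p) {f : ℕ → StrongDual ℝ E} (hf : IsDisjointSeq f)
    (hf0 : IsWeakStarNull f) {x : ℕ → E} (hx : IsWeaklyPSummable p x) {ε : ℝ} (hε : 0 < ε) :
    ∃ n, |f n (x n)| < ε := by
  by_contra! hle
  obtain ⟨B, hB⟩ := hx.exists_norm_le (zero_lt_one.trans_le hp)
  obtain ⟨C, hC⟩ := hf0.exists_norm_le
  obtain ⟨φ, hφ, z, hz, hzx, hfz⟩ := exists_strictMono_exists_disjoint_abs_le
    (fun n => abs_nonneg (x n)) (fun n => (norm_abs_eq_norm _).trans_le (hB n)) hC hε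
    (fun m => tendsto_abs_apply_of_disjoint hE hf hf0 (abs_nonneg (x m)))
    fun n => (hle n).trans (abs_apply_le (f n) (x n))
  have hzsum : IsWeaklyPSummable p z :=
    (hx.comp_injective hφ.injective).of_disjoint_of_abs_le hp hz hzx
  have hlim := tendstoUniformlyOn_zero_iff_forall_seq.1
    (h z hz hzsum (f ∘ φ) (hf0.comp_strictMono hφ)) z fun k => ⟨k, rfl⟩
  linarith [ge_of_tendsto' hlim fun k => (hfz k).le]

theorem HasDisjointDPStar.tendsto_apply (hE : IsSigmaDedekindComplete E) {p : ℝ} (hp : 1 ≤ p)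
    (h : HasDisjointDPStar E p) {f : ℕ → StrongDual ℝ E} (hf : IsDisjointSeq f)
    (hf0 : IsWeakStarNull f) {x : ℕ → E} (hx : IsWeaklyPSummable p x) :
    Tendsto (fun n => f n (x n)) atTop (𝓝 0) :=
  tendsto_zero_of_forall_strictMono_exists_abs_lt fun _ hε _ hφ =>
    h.exists_abs_apply_lt hE hp (hf.comp_injective hφ.injective) (hf0.comp_strictMono hφ)
      (hx.comp_injective hφ.injective) hε

theorem HasDisjointDPStar.hasPWeakDPStar (hE : IsSigmaDedekindComplete E) {p : ℝ} (hp : 1 ≤ p)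
    (h : HasDisjointDPStar E p) : HasPWeakDPStar E p := by
  refine fun A hA => ⟨hA.isBounded (zero_lt_one.trans_le hp), fun f hf hf0 => ?_⟩
  refine tendstoUniformlyOn_zero_iff_forall_seq.2 fun x hx => ?_
  refine tendsto_zero_of_forall_strictMono_exists_abs_lt fun ε hε φ hφ => ?_
  obtain ⟨a, -, ψ, hψ, hsum⟩ := hA (x ∘ φ) fun n => hx (φ n)
  have hmono : StrictMono (φ ∘ ψ) := hφ.comp hψ
  have hfa := isWeakStarNull_iff.1 (hf0.comp_strictMono hmono) a
  have hlim : Tendsto (fun k => f (φ (ψ k)) (x (φ (ψ k)))) atTop (𝓝 0) := by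
    simpa only [Function.comp_apply, ← map_add, sub_add_cancel, add_zero] using
      (h.tendsto_apply hE hp (hf.comp_injective hmono.injective) (hf0.comp_strictMono hmono)
        hsum).add hfa
  rw [tendsto_zero_iff_abs_tendsto_zero] at hlim
  obtain ⟨k, hk⟩ := (hlim.eventually_lt_const hε).exists
  exact ⟨ψ k, hk⟩

end BanachLattice

theorem theorem3p7_general {E : Type*} [NormedAddCommGroup E] [NormedSpace ℝ E] [CompleteSpace E]
    [Lattice E] [IsOrderedAddMonoid E] [IsOrderedModule ℝ E] [HasSolidNorm E]
    (hE : IsSigmaDedekindComplete E) {p : ℝ} (hp : 1 ≤ p) :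
    HasPWeakDPStar E p ↔ HasDisjointDPStar E p :=
  ⟨fun h => h.hasDisjointDPStar hE (zero_lt_one.trans_le hp), fun h => h.hasPWeakDPStar hE hp⟩

theorem theorem3p7 {E : Type*} [NormedAddCommGroup E] [NormedSpace ℝ E] [CompleteSpace E]
    [Lattice E] [IsOrderedAddMonoid E] [IsOrderedModule ℝ E] [HasSolidNorm E]
    (hE : IsSigmaDedekindComplete E) (p : ℝ) (hp : 1 ≤ p) :
    (HasPWeakDPStar E p → HasDisjointDPStar E p) ∧
      (2 ≤ p → (HasPWeakDPStar E p ↔ HasDisjointDPStar E p)) :=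
  ⟨(theorem3p7_general hE hp).1, fun _ => theorem3p7_general hE hp⟩
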